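/- **Setting.** Let $1<\alpha<2$. Put $g_k=(-1)^k\binom{\alpha}{k}$ and $q_k=\left(\tfrac32\right)^{\alpha}\sum_{m=0}^{k}3^{-m}g_m\,g_{k-m}$ for $k\ge 0$, $q_k=0$ for $k<0$ (so $\sum_k q_k\zeta^k=(\tfrac32-2\zeta+\tfrac12\zeta^2)^\alpha$). For integers $p,q,r,s$ and $n\in\mathbb N$ define the $n\times n$ matrices $$A_p=(q_{p+i-j})_{i,j=1}^n,\qquad A_{p,q}=\tfrac{q}{q-p}A_p+\tfrac{p}{p-q}A_q,\qquad A_{p,q,r,s}=\tfrac{3rs+2\alpha}{3(rs-pq)}A_{p,q}+\tfrac{3pq+2\alpha}{3(pq-rs)}A_{r,s},$$ and, for a further quadruple $\bar p,\bar q,\bar r,\bar s$ of integers, the fourth order matrix $$A_\alpha=\frac{a\bar b}{a\bar b-\bar a b}\,A_{p,q,r,s}+\frac{\bar a b}{\bar a b-a\bar b}\,A_{\bar p,\bar q,\bar r,\bar s},$$ where $a=rs-pq$, $b=6pqrs(r+s-p-q)+4\alpha[rs(r+s)-pq(p+q)]+9\alpha(rs-pq)$, and $\bar a,\bar b$ are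 given by the same formulas with $\bar p,\bar q,\bar r,\bar s$. Assume that all denominators are nonzero: $p\ne q$, $r\ne s$, $rs\ne pq$, $\bar p\neq\bar q$, $\bar r\ne\bar s$, $\bar r\bar s\ne\bar p\bar q$, $a\bar b\ne\bar a b$. Assume also that $(p,q,r,s,\bar p,\bar q,\bar r,\bar s)$ is one of the effective octuples: either $(1,2,1,-2,1,\bar q,1,\bar s)$ with $|\bar q|\ge2$, $|\bar s|\ge 2$, $\bar q\bar s<0$, $(\bar q,\bar s)\ne(2,-2)$, or one of $(1,2,1,0,1,2,1,-2)$, $(1,2,1,0,1,-1,1,-2)$, $(1,2,1,-1,1,2,1,-2)$, $(1,2,1,-1,1,-1,1,-2)$, $(1,0,1,-1,1,2,1,-2)$, $(1,0,1,-2,1,2,1,-2)$, $(1,-1,1,-2,1,2,1,-2)$. Let $x_L<x_R$, $T>0$, let $d_+,d_-$ be real functions with $d_+>0$ on $(x_L,x_R)$, and for integers $N_x,N_t\ge1$ let $h=(x_R-x_L)/N_x$, $\tau=T/N_t$, $x_i=x_L+ih$, $t_n=n\tau$, $D_\pm=\mathrm{diag}(d_\pm(x_1),\dots,d_\pm(x_{N_x-1}))$.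 With $A_\alpha$ of size $N_x-1$ and a source $f(x,t)$, the difference scheme is $$(I-A)U^{n+1}=(I+A)U^n+\tau F^{n+1/2},\quad 0\le n<N_t,\qquad A=\frac{\tau}{2h^\alpha}\left(D_+A_\alpha+D_-A_\alpha^{T}\right),$$ where $F^{n+1/2}_i=f\left(x_i,\tfrac{t_n+t_{n+1}}2\right)$. **Theorem 4.3.** Let $D_-=\kappa_\alpha D_+$ for all $N_x$, with a constant $\kappa_\alpha\ge0$. Then the scheme is unconditionally stable: for all $c_1\ge c_0>0$ there is a constant $K$ such that for all $N_x,N_t\ge 1$ (with no relation between $\tau$ and $h$) with $c_0\le d_+(x_i)\le c_1$ for $1\le i\le N_x-1$, for every source $f$ and any two solutions $(U^n)$, $(\widetilde U^n)$ of the scheme with this source, $$\|\widetilde U^n-U^n\|_2\le K\,\|\widetilde U^0-U^0\|_2\qquad(0\le n\le N_t).$$ Moreover, for all $N_x,N_t\ge1$, every (complex) eigenvalue of $A$ has negative real part, $I-A$ is invertible, and the amplification matrix $(I-A)^{-1}(I+A)$ has spectral radius less than $1$. -/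

import Mathlib

/-- `g k = (-1)^k * binom(α, k)`, the power series coefficients of `(1 - ζ)^α`. -/
noncomputable def gCoeff (α : ℝ) (k : ℕ) : ℝ := (-1) ^ k * Ring.choose α k

/-- The power series coefficients of `(3/2 - 2ζ + ζ²/2)^α`. -/
noncomputable def qCoeffNat (α : ℝ) (k : ℕ) : ℝ :=
  (3 / 2 : ℝ) ^ α * ∑ m ∈ Finset.range (k + 1), (1 / 3 : ℝ) ^ m * gCoeff α m * gCoeff α (k - m)

/-- The coefficients `q_k`, extended by `q_k = 0` for `k < 0`. -/
noncomputable def qCoeff (α : ℝ) (k : ℤ) : ℝ := if k < 0 then 0 else qCoeffNat α k.toNat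

/-- The `n × n` Toeplitz matrix of the Lubich operator with shift `p`. -/
noncomputable def lubichMatrix (α : ℝ) (n : ℕ) (p : ℤ) : Matrix (Fin n) (Fin n) ℝ :=
  Matrix.of fun i j => qCoeff α (p + (i : ℤ) - (j : ℤ))

/-- The weight `w_p = q / (q - p)` (and `w_q` is `weight₂ q p`). -/
noncomputable def weight₂ (p q : ℤ) : ℝ := (q : ℝ) / ((q : ℝ) - p)

/-- `A_{p,q} = w_p A_p + w_q A_q`. -/
noncomputable def wsldMatrix₂ (α : ℝ) (n : ℕ) (p q : ℤ) : Matrix (Fin n) (Fin n) ℝ :=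
  weight₂ p q • lubichMatrix α n p + weight₂ q p • lubichMatrix α n q

/-- The weight `w_{p,q} = (3rs + 2α) / (3(rs - pq))` (and `w_{r,s}` is `weight₃ α r s p q`). -/
noncomputable def weight₃ (α : ℝ) (p q r s : ℤ) : ℝ :=
  (3 * ((r : ℝ) * s) + 2 * α) / (3 * ((r : ℝ) * s - (p : ℝ) * q))

/-- `A_{p,q,r,s} = w_{p,q} A_{p,q} + w_{r,s} A_{r,s}`. -/
noncomputable def wsldMatrix₃ (α : ℝ) (n : ℕ) (p q r s : ℤ) : Matrix (Fin n) (Fin n) ℝ :=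
  weight₃ α p q r s • wsldMatrix₂ α n p q + weight₃ α r s p q • wsldMatrix₂ α n r s

/-- `a_{p,q,r,s} = rs - pq`. -/
def aConst (p q r s : ℤ) : ℝ := (r : ℝ) * s - (p : ℝ) * q

/-- `b_{p,q,r,s} = 6pqrs(r+s-p-q) + 4α[rs(r+s) - pq(p+q)] + 9α(rs - pq)`. -/
noncomputable def bConst (α : ℝ) (p q r s : ℤ) : ℝ :=
  6 * ((p : ℝ) * q * r * s) * ((r : ℝ) + s - p - q)
    + 4 * α * ((r : ℝ) * s * ((r : ℝ) + s) - (p : ℝ) * q * ((p : ℝ) + q))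
    + 9 * α * ((r : ℝ) * s - (p : ℝ) * q)

/-- The eight integer shifts `(p, q, r, s, p', q', r', s')` of a fourth order WSLD operator. -/
structure WSLDShifts where
  p : ℤ
  q : ℤ
  r : ℤ
  s : ℤ
  p' : ℤ
  q' : ℤ
  r' : ℤ
  s' : ℤ

namespace WSLDShifts

/-- All denominators of the weights are nonzero, so that the fourth order operator is defined. -/
def Admissible (S : WSLDShifts) (α : ℝ) : Prop :=
  S.p ≠ S.q ∧ S.r ≠ S.s ∧ S.r * S.s ≠ S.p * S.q ∧
  S.p' ≠ S.q' ∧ S.r' ≠ S.s' ∧ S.r' * S.s' ≠ S.p' * S.q' ∧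
  aConst S.p S.q S.r S.s * bConst α S.p' S.q' S.r' S.s' ≠
    aConst S.p' S.q' S.r' S.s' * bConst α S.p S.q S.r S.s

/-- The shifts of the effective fourth order schemes: one infinite family and seven further
octuples. -/
def Effective (S : WSLDShifts) : Prop :=
  (∃ q s : ℤ, 2 ≤ |q| ∧ 2 ≤ |s| ∧ (q, s) ≠ (2, -2) ∧ q * s < 0 ∧ S = ⟨1, 2, 1, -2, 1, q, 1, s⟩) ∨
  S = ⟨1, 2, 1, 0, 1, 2, 1, -2⟩ ∨
  S = ⟨1, 2, 1, 0, 1, -1, 1, -2⟩ ∨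
  S = ⟨1, 2, 1, -1, 1, 2, 1, -2⟩ ∨
  S = ⟨1, 2, 1, -1, 1, -1, 1, -2⟩ ∨
  S = ⟨1, 0, 1, -1, 1, 2, 1, -2⟩ ∨
  S = ⟨1, 0, 1, -2, 1, 2, 1, -2⟩ ∨
  S = ⟨1, -1, 1, -2, 1, 2, 1, -2⟩

/-- The weight `a b' / (a b' - a' b)` of the first third order operator. -/
noncomputable def weight₄ (S : WSLDShifts) (α : ℝ) : ℝ :=
  aConst S.p S.q S.r S.s * bConst α S.p' S.q' S.r' S.s' /
    (aConst S.p S.q S.r S.s * bConst α S.p' S.q' S.r' S.s' -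
      aConst S.p' S.q' S.r' S.s' * bConst α S.p S.q S.r S.s)

/-- The weight `a' b / (a' b - a b')` of the second third order operator. -/
noncomputable def weight₄' (S : WSLDShifts) (α : ℝ) : ℝ :=
  aConst S.p' S.q' S.r' S.s' * bConst α S.p S.q S.r S.s /
    (aConst S.p' S.q' S.r' S.s' * bConst α S.p S.q S.r S.s -
      aConst S.p S.q S.r S.s * bConst α S.p' S.q' S.r' S.s')

/-- The `n × n` matrix `A_α` of the fourth order WSLD operator. -/
noncomputable def matrix (S : WSLDShifts) (α : ℝ) (n : ℕ) : Matrix (Fin n) (Fin n) ℝ :=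
  S.weight₄ α • wsldMatrix₃ α n S.p S.q S.r S.s +
    S.weight₄' α • wsldMatrix₃ α n S.p' S.q' S.r' S.s'

end WSLDShifts

/-- The spatial step `h = (x_R - x_L) / N_x`. -/
noncomputable def meshStep (xL xR : ℝ) (Nx : ℕ) : ℝ := (xR - xL) / Nx

/-- The interior mesh points: the index `i : Fin (N_x - 1)` stands for `x_{i+1} = x_L + (i+1)h`. -/
noncomputable def meshPoint (xL xR : ℝ) (Nx : ℕ) (i : Fin (Nx - 1)) : ℝ :=
  xL + ((i : ℝ) + 1) * meshStep xL xR Nx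

/-- The diagonal matrix with entries `d(x_1), …, d(x_{N_x - 1})`. -/
noncomputable def coeffMatrix (xL xR : ℝ) (d : ℝ → ℝ) (Nx : ℕ) :
    Matrix (Fin (Nx - 1)) (Fin (Nx - 1)) ℝ :=
  Matrix.diagonal fun i => d (meshPoint xL xR Nx i)

/-- `A = τ / (2 h^α) * (D₊ A_α + D₋ A_αᵀ)`, with `τ = T / N_t`. -/
noncomputable def schemeMatrix (S : WSLDShifts) (α xL xR T : ℝ) (dp dm : ℝ → ℝ) (Nx Nt : ℕ) :
    Matrix (Fin (Nx - 1)) (Fin (Nx - 1)) ℝ :=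
  ((T / Nt) / (2 * meshStep xL xR Nx ^ α)) •
    (coeffMatrix xL xR dp Nx * S.matrix α (Nx - 1) +
      coeffMatrix xL xR dm Nx * (S.matrix α (Nx - 1)).transpose)

/-- The amplification matrix `(I - A)⁻¹ (I + A)`. -/
noncomputable def amplificationMatrix (S : WSLDShifts) (α xL xR T : ℝ) (dp dm : ℝ → ℝ)
    (Nx Nt : ℕ) : Matrix (Fin (Nx - 1)) (Fin (Nx - 1)) ℝ :=
  (1 - schemeMatrix S α xL xR T dp dm Nx Nt)⁻¹ * (1 + schemeMatrix S α xL xR T dp dm Nx Nt)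

/-- `U 0, …, U N_t` solves the Crank–Nicolson difference scheme
`(I - A) U^{n+1} = (I + A) U^n + τ F^{n+1/2}`, where `F^{n+1/2}_i = f(x_i, (t_n + t_{n+1})/2)`. -/
def IsSchemeSolution (S : WSLDShifts) (α xL xR T : ℝ) (dp dm : ℝ → ℝ) (f : ℝ → ℝ → ℝ)
    (Nx Nt : ℕ) (U : ℕ → Fin (Nx - 1) → ℝ) : Prop :=
  ∀ n < Nt,
    (1 - schemeMatrix S α xL xR T dp dm Nx Nt).mulVec (U (n + 1)) =
      (1 + schemeMatrix S α xL xR T dp dm Nx Nt).mulVec (U n) +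
        (T / Nt) • fun i => f (meshPoint xL xR Nx i) (((n : ℝ) + 1 / 2) * (T / Nt))

/-- Unconditional stability: errors in the initial data are not amplified in the Euclidean norm by
more than a constant factor, at any time level and with no restriction relating the time step to
the space step. The factor is independent of `N_x`, `N_t`, the time level, the source and the data;
it depends on the mesh only through positive bounds for `d₊` at the mesh points. -/
def UnconditionallyStable (S : WSLDShifts) (α xL xR T : ℝ) (dp dm : ℝ → ℝ) : Prop :=
  ∀ c₀ c₁ : ℝ, 0 < c₀ → ∃ K : ℝ, ∀ Nx Nt : ℕ, 0 < Nx → 0 < Nt →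
    (∀ i : Fin (Nx - 1), c₀ ≤ dp (meshPoint xL xR Nx i) ∧ dp (meshPoint xL xR Nx i) ≤ c₁) →
    ∀ (f : ℝ → ℝ → ℝ) (U V : ℕ → Fin (Nx - 1) → ℝ),
      IsSchemeSolution S α xL xR T dp dm f Nx Nt U →
      IsSchemeSolution S α xL xR T dp dm f Nx Nt V →
      ∀ n ≤ Nt, ‖WithLp.toLp 2 (V n - U n)‖ ≤ K * ‖WithLp.toLp 2 (V 0 - U 0)‖

/-! Since `D₋ = κ D₊`, the scheme matrix is `D₊ B` with `B` a positive multiple of `A_α + κ A_αᵀ`,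
and `v ⬝ᵥ B v` is a positive multiple of `v ⬝ᵥ A_α v`. Everything therefore follows from negative
definiteness of `A_α` (`quadratic_form_neg`). In the weighted inner product `∑ u i * v i / d i` the
factor `D₊` disappears: Crank–Nicolson steps do not increase the weighted norm, eigenvalues of `A`
have negative real part, and the Cayley transform sends them into the open unit disc. The bounds on
`d₊` make the weighted and the Euclidean norm equivalent.

The form `v ⬝ᵥ A_α v` is a mean over the circle of `|trigSum v x|²` times the symbol, the weighted
sum over the shifts `p` of `Re (w^α e^{-ipx})` with `w = 3/2 - 2ζ + ζ²/2`, `ζ = e^{ix}`. The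
exponent is removed by writing `w^α = c w + d w²` with `c, d > 0` (`exists_powerSymbol_eq`), which
is possible because `1 < α < 2` and a continuous argument of `w` stays in `(-π, π)`. It remains to
bound the sums for `w` and `w²`, which at fixed shifts are polynomials in `cos x`
(`sum_baseSymbol_neg`). For `α ≤ 3/2` the sum for `w²` can be positive, and the extra information `2
(1 - cos x) d < c` lets the sum for `w` absorb it.

The weights are tamed by the order conditions: as functionals of `f`, the fourth order operators
take the values `1, 0, 2α/3, -3α/2` at `1, p, p², p³`. On four nodes this determines the functional,
on the nodes `-2, …, 2` it does so up to a multiple `ν` of `centralDiff`. The infinite family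
consists of convex combinations of functionals on `1, 2, -2, k` with `|k| ≥ 3`; the seven other
octuples are five-point functionals with explicit `ν`. -/

/-! ### Sign and size of interpolation remainders on the integers. -/

/-- The remainder at `k` of quadratic interpolation at the nodes `1, 2, -2`. -/
noncomputable def interpRem (f : ℤ → ℝ) (k : ℤ) : ℝ :=
  f k + ((k : ℝ) ^ 2 - 4) / 3 * f 1 - ((k : ℝ) - 1) * (k + 2) / 4 * f 2
    - ((k : ℝ) - 1) * (k - 2) / 12 * f (-2)

/-- The node polynomial `(k - 1) (k - 2) (k + 2)`. -/
def nodePoly (k : ℤ) : ℝ := ((k : ℝ) - 1) * ((k : ℝ) ^ 2 - 4)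

/-- Discrete analogue of a function with nonnegative third derivative and three zeros. The
differences based at `-2, -1, 0` give `g (-1) ≥ g 0 ≥ 0` and `g 3 ≥ g 0`; from there, value, first
and second difference are propagated together in each direction. -/
theorem sign_of_third_difference_nonneg {g : ℤ → ℝ} (h1 : g 1 = 0) (h2 : g 2 = 0)
    (h3 : g (-2) = 0) (hd : ∀ j, 0 ≤ g (j + 3) - 3 * g (j + 2) + 3 * g (j + 1) - g j) (n : ℕ) :
    0 ≤ g (2 + n) ∧ g (-2 - n) ≤ 0 := by
  have e1 := hd (-2)
  have e2 := hd (-1)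
  have e3 := hd 0
  norm_num [h1, h2, h3] at e1 e2 e3
  constructor
  · suffices H : 0 ≤ g (2 + n) ∧ 0 ≤ g (2 + n + 1) - g (2 + n) ∧
        0 ≤ g (2 + n + 1) - 2 * g (2 + n) + g (2 + n - 1) from H.1
    induction n with
    | zero => norm_num [h1, h2]; linarith
    | succ n ih =>
      have e := hd (2 + n - 1)
      push_cast
      rw [show (2 + n - 1 + 3 : ℤ) = 2 + (n + 1) + 1 by ring,
        show (2 + n - 1 + 2 : ℤ) = 2 + (n + 1) by ring,
        show (2 + n - 1 + 1 : ℤ) = 2 + n by ring] at e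
      rw [show (2 + (n + 1) - 1 : ℤ) = 2 + n by ring]
      rw [show (2 + n + 1 : ℤ) = 2 + (n + 1) by ring] at ih
      obtain ⟨a, b, c⟩ := ih
      exact ⟨by linarith, by linarith, by linarith⟩
  · suffices H : g (-2 - n) ≤ 0 ∧ 0 ≤ g (-2 - n + 1) - g (-2 - n) ∧
        g (-2 - n + 2) - 2 * g (-2 - n + 1) + g (-2 - n) ≤ 0 from H.1
    induction n with
    | zero => norm_num [h3]; constructor <;> linarith
    | succ n ih =>
      have e := hd (-2 - (n + 1))
      push_cast
      rw [show (-2 - (n + 1) + 3 : ℤ) = -2 - n + 2 by ring,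
        show (-2 - (n + 1) + 2 : ℤ) = -2 - n + 1 by ring,
        show (-2 - (n + 1) + 1 : ℤ) = -2 - n by ring] at e
      rw [show (-2 - (n + 1) + 2 : ℤ) = -2 - n + 1 by ring,
        show (-2 - (n + 1) + 1 : ℤ) = -2 - n by ring]
      obtain ⟨a, b, c⟩ := ih
      exact ⟨by linarith, by linarith, by linarith⟩

theorem interpRem_sign {f : ℤ → ℝ}
    (hd : ∀ j, 0 ≤ f (j + 3) - 3 * f (j + 2) + 3 * f (j + 1) - f j) {k : ℤ} (hk : 2 ≤ |k|) :
    (0 ≤ k → 0 ≤ interpRem f k) ∧ (k ≤ 0 → interpRem f k ≤ 0) := by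
  -- The remainder differs from `f` by a quadratic polynomial, so both have the same third
  -- differences.
  have key := sign_of_third_difference_nonneg (g := interpRem f) (by norm_num [interpRem])
    (by norm_num [interpRem]) (by norm_num [interpRem]) (fun j => by
      have := hd j
      simp only [interpRem]
      push_cast
      linarith) (k.natAbs - 2)
  have hc : ((k.natAbs - 2 : ℕ) : ℤ) = |k| - 2 := by
    rw [Int.abs_eq_natAbs] at *; omega
  rw [hc] at key
  constructor
  · intro h
    rw [abs_of_nonneg h] at key
    simpa using key.1
  · intro h
    rw [abs_of_nonpos h, show (-2 - (-k - 2) : ℤ) = k by ring] at key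
    exact key.2

theorem nodePoly_pos {k : ℤ} (hk : 3 ≤ k) : 0 < nodePoly k := by
  have : (3 : ℝ) ≤ k := by exact_mod_cast hk
  unfold nodePoly
  exact mul_pos (by linarith) (by nlinarith)

theorem nodePoly_neg {k : ℤ} (hk : k ≤ -3) : nodePoly k < 0 := by
  have : (k : ℝ) ≤ -3 := by exact_mod_cast hk
  unfold nodePoly
  exact mul_neg_of_neg_of_pos (by linarith) (by nlinarith)

/-- Divided differences at `1, 2, -2, k` are bounded by a sixth of the third differences. -/
theorem abs_interpRem_div_le {f : ℤ → ℝ} {c : ℝ}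
    (hd : ∀ j, |f (j + 3) - 3 * f (j + 2) + 3 * f (j + 1) - f j| ≤ c) {k : ℤ} (hk : 3 ≤ |k|) :
    |interpRem f k / nodePoly k| ≤ c / 6 := by
  -- The cubic `c p³ / 6` has constant third difference `c` and remainder `c / 6 * nodePoly k`, so
  -- it dominates both `f` and `-f`.
  have h1 := interpRem_sign (f := fun p => c * (p : ℝ) ^ 3 / 6 + f p) (fun j => by
    have := (abs_le.1 (hd j)).1
    push_cast
    linarith) (by omega : 2 ≤ |k|)
  have h2 := interpRem_sign (f := fun p => c * (p : ℝ) ^ 3 / 6 - f p) (fun j => by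
    have := (abs_le.1 (hd j)).2
    push_cast
    linarith) (by omega : 2 ≤ |k|)
  have e1 : interpRem (fun p => c * (p : ℝ) ^ 3 / 6 + f p) k
      = c / 6 * nodePoly k + interpRem f k := by
    simp only [interpRem, nodePoly]; push_cast; ring
  have e2 : interpRem (fun p => c * (p : ℝ) ^ 3 / 6 - f p) k
      = c / 6 * nodePoly k - interpRem f k := by
    simp only [interpRem, nodePoly]; push_cast; ring
  rw [e1] at h1
  rw [e2] at h2
  rcases le_abs'.1 hk with hk | hk
  · have hn := nodePoly_neg hk
    have a := h1.2 (by omega)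
    have b := h2.2 (by omega)
    rw [abs_le, le_div_iff_of_neg hn, div_le_iff_of_neg hn]
    constructor <;> linarith
  · have hn := nodePoly_pos hk
    have a := h1.1 (by omega)
    have b := h2.1 (by omega)
    rw [abs_le, le_div_iff₀ hn, div_le_iff₀ hn]
    constructor <;> linarith

/-! ### The generating polynomial and its square on the unit circle. -/

/-- The value at `e^{ix}` of the generating polynomial `3/2 - 2ζ + ζ²/2`. -/
noncomputable def baseSymbol (x : ℝ) : ℂ :=
  3 / 2 - 2 * Complex.exp (x * Complex.I) + 1 / 2 * Complex.exp (x * Complex.I) ^ 2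

/-- The real part of `w e^{-ipx}`. -/
noncomputable def shiftedRe (w : ℂ) (x : ℝ) (p : ℤ) : ℝ :=
  (w * Complex.exp (-(p * x : ℝ) * Complex.I)).re

theorem baseSymbol_re (x : ℝ) : (baseSymbol x).re = (1 - Real.cos x) ^ 2 := by
  have h2 : Complex.exp (x * Complex.I) ^ 2 = Complex.exp ((2 * x : ℝ) * Complex.I) := by
    rw [← Complex.exp_nat_mul]; push_cast; ring_nf
  have e : baseSymbol x = ((3 / 2 : ℝ) : ℂ) - ((2 : ℝ) : ℂ) * Complex.exp (x * Complex.I)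
      + ((1 / 2 : ℝ) : ℂ) * Complex.exp ((2 * x : ℝ) * Complex.I) := by
    rw [← h2, baseSymbol]; push_cast; rfl
  rw [e, Complex.add_re, Complex.sub_re, Complex.re_ofReal_mul, Complex.re_ofReal_mul,
    Complex.exp_ofReal_mul_I_re, Complex.exp_ofReal_mul_I_re, Complex.ofReal_re, Real.cos_two_mul]
  ring

theorem baseSymbol_im (x : ℝ) : (baseSymbol x).im = -(Real.sin x * (2 - Real.cos x)) := by
  have h2 : Complex.exp (x * Complex.I) ^ 2 = Complex.exp ((2 * x : ℝ) * Complex.I) := by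
    rw [← Complex.exp_nat_mul]; push_cast; ring_nf
  have e : baseSymbol x = ((3 / 2 : ℝ) : ℂ) - ((2 : ℝ) : ℂ) * Complex.exp (x * Complex.I)
      + ((1 / 2 : ℝ) : ℂ) * Complex.exp ((2 * x : ℝ) * Complex.I) := by
    rw [← h2, baseSymbol]; push_cast; rfl
  rw [e, Complex.add_im, Complex.sub_im, Complex.im_ofReal_mul, Complex.im_ofReal_mul,
    Complex.exp_ofReal_mul_I_im, Complex.exp_ofReal_mul_I_im, Complex.ofReal_im, Real.sin_two_mul]
  ring

theorem norm_baseSymbol_sq (x : ℝ) :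
    ‖baseSymbol x‖ ^ 2 = (1 - Real.cos x) * (5 - 3 * Real.cos x) := by
  rw [← Complex.normSq_eq_norm_sq, Complex.normSq_apply, baseSymbol_re, baseSymbol_im]
  linear_combination (2 - Real.cos x) ^ 2 * Real.sin_sq x

theorem shiftedRe_baseSymbol (x : ℝ) (p : ℤ) :
    shiftedRe (baseSymbol x) x p = 3 / 2 * Real.cos (p * x) - 2 * Real.cos ((p - 1) * x)
      + 1 / 2 * Real.cos ((p - 2) * x) := by
  have e : baseSymbol x * Complex.exp (-(p * x : ℝ) * Complex.I)
      = ((3 / 2 : ℝ) : ℂ) * Complex.exp ((-(p * x) : ℝ) * Complex.I)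
        - ((2 : ℝ) : ℂ) * Complex.exp ((-((p - 1) * x) : ℝ) * Complex.I)
        + ((1 / 2 : ℝ) : ℂ) * Complex.exp ((-((p - 2) * x) : ℝ) * Complex.I) := by
    have h1 : Complex.exp ((-((p - 1) * x) : ℝ) * Complex.I)
        = Complex.exp (x * Complex.I) * Complex.exp (-(p * x : ℝ) * Complex.I) := by
      rw [← Complex.exp_add]; push_cast; ring_nf
    have h2 : Complex.exp ((-((p - 2) * x) : ℝ) * Complex.I)
        = Complex.exp (x * Complex.I) ^ 2 * Complex.exp (-(p * x : ℝ) * Complex.I) := by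
      rw [← Complex.exp_nat_mul, ← Complex.exp_add]; push_cast; ring_nf
    rw [h1, h2, baseSymbol]; push_cast; ring
  rw [shiftedRe, e, Complex.add_re, Complex.sub_re, Complex.re_ofReal_mul, Complex.re_ofReal_mul,
    Complex.re_ofReal_mul, Complex.exp_ofReal_mul_I_re, Complex.exp_ofReal_mul_I_re,
    Complex.exp_ofReal_mul_I_re, Real.cos_neg, Real.cos_neg, Real.cos_neg]

theorem shiftedRe_baseSymbol_sq (x : ℝ) (p : ℤ) :
    shiftedRe (baseSymbol x ^ 2) x p = 3 / 2 * shiftedRe (baseSymbol x) x p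
      - 2 * shiftedRe (baseSymbol x) x (p - 1) + 1 / 2 * shiftedRe (baseSymbol x) x (p - 2) := by
  have e : baseSymbol x ^ 2 * Complex.exp (-(p * x : ℝ) * Complex.I)
      = ((3 / 2 : ℝ) : ℂ) * (baseSymbol x * Complex.exp (-(p * x : ℝ) * Complex.I))
        - ((2 : ℝ) : ℂ) * (baseSymbol x * Complex.exp (-(((p - 1 : ℤ) : ℝ) * x : ℝ) * Complex.I))
        + ((1 / 2 : ℝ) : ℂ) *
          (baseSymbol x * Complex.exp (-(((p - 2 : ℤ) : ℝ) * x : ℝ) * Complex.I)) := by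
    have h1 : Complex.exp (-(((p - 1 : ℤ) : ℝ) * x : ℝ) * Complex.I)
        = Complex.exp (x * Complex.I) * Complex.exp (-(p * x : ℝ) * Complex.I) := by
      rw [← Complex.exp_add]; push_cast; ring_nf
    have h2 : Complex.exp (-(((p - 2 : ℤ) : ℝ) * x : ℝ) * Complex.I)
        = Complex.exp (x * Complex.I) ^ 2 * Complex.exp (-(p * x : ℝ) * Complex.I) := by
      rw [← Complex.exp_nat_mul, ← Complex.exp_add]; push_cast; ring_nf
    rw [h1, h2, sq, baseSymbol]; push_cast; ring
  rw [shiftedRe, e, Complex.add_re, Complex.sub_re, Complex.re_ofReal_mul, Complex.re_ofReal_mul,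
    Complex.re_ofReal_mul]
  rfl

theorem cos_succ_mul (n x : ℝ) :
    Real.cos ((n + 1) * x) = 2 * Real.cos x * Real.cos (n * x) - Real.cos ((n - 1) * x) := by
  rw [add_mul, sub_mul, one_mul, Real.cos_add, Real.cos_sub]; ring

/-- Chebyshev expansion in `cos x`. The shifts `-3` and `-4` are needed only for the square, where
`shiftedRe_baseSymbol_sq` lowers the shift by up to two. -/
theorem shiftedRe_baseSymbol_values (x : ℝ) :
    shiftedRe (baseSymbol x) x 1 = -2 + 2 * Real.cos x ∧
    shiftedRe (baseSymbol x) x 2 = -1 - 2 * Real.cos x + 3 * Real.cos x ^ 2 ∧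
    shiftedRe (baseSymbol x) x 0 = (1 - Real.cos x) ^ 2 ∧
    shiftedRe (baseSymbol x) x (-1) = 2 - 4 * Real.cos x ^ 2 + 2 * Real.cos x ^ 3 ∧
    shiftedRe (baseSymbol x) x (-2) =
      -1 + 6 * Real.cos x - Real.cos x ^ 2 - 8 * Real.cos x ^ 3 + 4 * Real.cos x ^ 4 ∧
    shiftedRe (baseSymbol x) x (-3) =
      -2 - 2 * Real.cos x + 16 * Real.cos x ^ 2 - 4 * Real.cos x ^ 3 - 16 * Real.cos x ^ 4
        + 8 * Real.cos x ^ 5 ∧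
    shiftedRe (baseSymbol x) x (-4) =
      1 - 10 * Real.cos x - 3 * Real.cos x ^ 2 + 40 * Real.cos x ^ 3 - 12 * Real.cos x ^ 4
        - 32 * Real.cos x ^ 5 + 16 * Real.cos x ^ 6 := by
  have c2 := cos_succ_mul 1 x
  have c3 := cos_succ_mul 2 x
  have c4 := cos_succ_mul 3 x
  have c5 := cos_succ_mul 4 x
  have c6 := cos_succ_mul 5 x
  norm_num at c2 c3 c4 c5 c6
  simp only [shiftedRe_baseSymbol]
  norm_num
  rw [c6, c5, c4, c3, c2]
  refine ⟨?_, ?_, ?_, ?_, ?_, ?_, ?_⟩ <;> ring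

theorem shiftedRe_baseSymbol_sq_values (x : ℝ) :
    shiftedRe (baseSymbol x ^ 2) x 1 =
      -4 + 7 * Real.cos x - 4 * Real.cos x ^ 2 + Real.cos x ^ 3 ∧
    shiftedRe (baseSymbol x ^ 2) x 2 = 3 - 8 * Real.cos x + 5 * Real.cos x ^ 2 ∧
    shiftedRe (baseSymbol x ^ 2) x 0 =
      -3 + 9 * Real.cos x ^ 2 - 8 * Real.cos x ^ 3 + 2 * Real.cos x ^ 4 ∧
    shiftedRe (baseSymbol x ^ 2) x (-1) =
      4 - 13 * Real.cos x + 4 * Real.cos x ^ 2 + 17 * Real.cos x ^ 3 - 16 * Real.cos x ^ 4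
        + 4 * Real.cos x ^ 5 ∧
    shiftedRe (baseSymbol x ^ 2) x (-2) =
      3 + 8 * Real.cos x - 35 * Real.cos x ^ 2 + 16 * Real.cos x ^ 3 + 32 * Real.cos x ^ 4
        - 32 * Real.cos x ^ 5 + 8 * Real.cos x ^ 6 := by
  obtain ⟨e1, e2, e0, e1', e2', e3', e4'⟩ := shiftedRe_baseSymbol_values x
  simp only [shiftedRe_baseSymbol_sq]
  norm_num
  rw [e1, e2, e0, e1', e2', e3', e4']
  refine ⟨?_, ?_, ?_, ?_, ?_⟩ <;> ring

theorem abs_shiftedRe_le (w : ℂ) (x : ℝ) (p : ℤ) : |shiftedRe w x p| ≤ ‖w‖ := by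
  refine (Complex.abs_re_le_norm _).trans ?_
  rw [norm_mul, ← Complex.ofReal_neg, Complex.norm_exp_ofReal_mul_I, mul_one]

theorem norm_one_sub_exp_sq (x : ℝ) :
    ‖Complex.exp (-x * Complex.I) - 1‖ ^ 2 = 2 - 2 * Real.cos x := by
  rw [← Complex.ofReal_neg, ← Complex.normSq_eq_norm_sq, Complex.normSq_apply]
  simp only [Complex.sub_re, Complex.sub_im, Complex.exp_ofReal_mul_I_re,
    Complex.exp_ofReal_mul_I_im, Complex.one_re, Complex.one_im, Real.cos_neg, Real.sin_neg]
  linear_combination Real.sin_sq_add_cos_sq x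

theorem norm_one_sub_exp (x : ℝ) :
    ‖Complex.exp (-x * Complex.I) - 1‖ = √(2 - 2 * Real.cos x) := by
  rw [← norm_one_sub_exp_sq, Real.sqrt_sq (norm_nonneg _)]

/-- A unit difference in the shift multiplies `w` by `e^{-ix} - 1`, of modulus `√(2 - 2 cos x)`. -/
theorem abs_third_difference_shiftedRe_le (w : ℂ) (x : ℝ) (p : ℤ) :
    |shiftedRe w x (p + 3) - 3 * shiftedRe w x (p + 2) + 3 * shiftedRe w x (p + 1)
      - shiftedRe w x p| ≤ ‖w‖ * √(2 - 2 * Real.cos x) ^ 3 := by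
  have h (n : ℕ) : Complex.exp (-(((p + n : ℤ) : ℝ) * x : ℝ) * Complex.I)
      = Complex.exp (-x * Complex.I) ^ n * Complex.exp (-(p * x : ℝ) * Complex.I) := by
    rw [← Complex.exp_nat_mul, ← Complex.exp_add]; push_cast; ring_nf
  have h1 := h 1
  have h2 := h 2
  have h3 := h 3
  push_cast at h1 h2 h3
  have e : shiftedRe w x (p + 3) - 3 * shiftedRe w x (p + 2) + 3 * shiftedRe w x (p + 1)
      - shiftedRe w x p = shiftedRe (w * (Complex.exp (-x * Complex.I) - 1) ^ 3) x p := by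
    have : w * (Complex.exp (-x * Complex.I) - 1) ^ 3 * Complex.exp (-(p * x : ℝ) * Complex.I)
        = w * (Complex.exp (-x * Complex.I) ^ 3 * Complex.exp (-(p * x : ℝ) * Complex.I))
          - ((3 : ℝ) : ℂ) *
            (w * (Complex.exp (-x * Complex.I) ^ 2 * Complex.exp (-(p * x : ℝ) * Complex.I)))
          + ((3 : ℝ) : ℂ) *
            (w * (Complex.exp (-x * Complex.I) ^ 1 * Complex.exp (-(p * x : ℝ) * Complex.I)))
          - w * Complex.exp (-(p * x : ℝ) * Complex.I) := by
      push_cast; ring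
    simp only [shiftedRe]
    rw [this, Complex.sub_re, Complex.add_re, Complex.sub_re, Complex.re_ofReal_mul,
      Complex.re_ofReal_mul]
    push_cast
    rw [h1, h2, h3]
  rw [e]
  refine (abs_shiftedRe_le _ _ _).trans ?_
  rw [norm_mul, norm_pow, norm_one_sub_exp]

/-! ### Normal forms of the third and fourth order functionals. -/

/-- The third order combination of the values at the shifts `1, 2, -2`. -/
noncomputable def thirdOrder (α : ℝ) (f : ℤ → ℝ) : ℝ :=
  (4 - 2 * α / 3) / 3 * f 1 + (2 * α / 3 - 2) / 4 * f 2 + (2 * α / 3 + 2) / 12 * f (-2)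

/-- The fourth order combination of the values at the shifts `1, 2, -2, k`. -/
noncomputable def fourthOrder (α : ℝ) (f : ℤ → ℝ) (k : ℤ) : ℝ :=
  thirdOrder α f + (4 - 13 * α / 6) * (interpRem f k / nodePoly k)

/-- The divided difference at the shifts `-2, -1, 0, 1, 2`. -/
noncomputable def centralDiff (f : ℤ → ℝ) : ℝ :=
  (f 2 + f (-2)) / 24 - (f 1 + f (-1)) / 6 + f 0 / 4

/-- The factor `4 - 13α/6` comes from the third moment: `thirdOrder` gives `2α/3 - 4` at `p³`, the
divided difference gives `1`, and the order condition asks for `-3α/2`. -/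
theorem fourthOrder_neg_one (α : ℝ) (f : ℤ → ℝ) : fourthOrder α f (-1) =
    thirdOrder α f + (4 - 13 * α / 6) / 6 * (f (-1) - f 1 + 1 / 2 * f 2 - 1 / 2 * f (-2)) := by
  simp only [fourthOrder, interpRem, nodePoly]; push_cast; ring

/-- Reduces sign conditions for `1 ≤ α ≤ 2` to the two endpoints. -/
theorem fourthOrder_affine (f : ℤ → ℝ) (k : ℤ) (α : ℝ) :
    fourthOrder α f k = (2 - α) * fourthOrder 1 f k + (α - 1) * fourthOrder 2 f k := by
  simp only [fourthOrder, thirdOrder]; ring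

/-- A function affine in two variables is nonpositive on the quadrilateral
`a₀ ≤ a ≤ a₁`, `l ≤ v ≤ p + q a` if it is nonpositive at the vertices. -/
theorem affine_nonpos_of_vertices {c d e a₀ a₁ l p q a v : ℝ} (h₀ : a₀ ≤ a) (h₁ : a ≤ a₁)
    (ha : a₀ < a₁) (hl : l ≤ v) (hv : v ≤ p + q * a)
    (v1 : c + d * a₀ + e * l ≤ 0) (v2 : c + d * a₀ + e * (p + q * a₀) ≤ 0)
    (v3 : c + d * a₁ + e * l ≤ 0) (v4 : c + d * a₁ + e * (p + q * a₁) ≤ 0) :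
    c + d * a + e * v ≤ 0 := by
  have hlow : c + d * a + e * l ≤ 0 := by
    have : (a₁ - a₀) * (c + d * a + e * l) ≤ 0 := by
      nlinarith [mul_nonneg (sub_nonneg.2 h₁) (neg_nonneg.2 v1),
        mul_nonneg (sub_nonneg.2 h₀) (neg_nonneg.2 v3)]
    exact nonpos_of_mul_nonpos_right this (by linarith)
  have hup : c + d * a + e * (p + q * a) ≤ 0 := by
    have : (a₁ - a₀) * (c + d * a + e * (p + q * a)) ≤ 0 := by
      nlinarith [mul_nonneg (sub_nonneg.2 h₁) (neg_nonneg.2 v2),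
        mul_nonneg (sub_nonneg.2 h₀) (neg_nonneg.2 v4)]
    exact nonpos_of_mul_nonpos_right this (by linarith)
  rcases le_total 0 e with he | he
  · exact le_trans (by nlinarith) hup
  · exact le_trans (by nlinarith) hlow

theorem affine_neg_of_vertices {c d e a₀ a₁ l p q a v : ℝ} (h₀ : a₀ ≤ a) (h₁ : a ≤ a₁)
    (ha : a₀ < a₁) (hl : l ≤ v) (hv : v ≤ p + q * a)
    (v1 : c + d * a₀ + e * l < 0) (v2 : c + d * a₀ + e * (p + q * a₀) < 0)
    (v3 : c + d * a₁ + e * l < 0) (v4 : c + d * a₁ + e * (p + q * a₁) < 0) :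
    c + d * a + e * v < 0 := by
  -- The largest vertex value `t` is moved into the constant term, which leaves the non-strict case.
  obtain ⟨t, ht, t1, t2, t3, t4⟩ : ∃ t < 0, c + d * a₀ + e * l ≤ t ∧
      c + d * a₀ + e * (p + q * a₀) ≤ t ∧ c + d * a₁ + e * l ≤ t ∧
      c + d * a₁ + e * (p + q * a₁) ≤ t := by
    refine ⟨max (max (c + d * a₀ + e * l) (c + d * a₀ + e * (p + q * a₀)))
      (max (c + d * a₁ + e * l) (c + d * a₁ + e * (p + q * a₁))), ?_, ?_⟩
    · simp only [max_lt_iff]; exact ⟨⟨v1, v2⟩, v3, v4⟩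
    · simp
  have := affine_nonpos_of_vertices (c := c - t) (d := d) (e := e) h₀ h₁ ha hl hv
    (by linarith) (by linarith) (by linarith) (by linarith)
  linarith

/-! ### Sign of the five-point functionals on the shifts `-2, …, 2`. -/

section FivePoint

variable (x : ℝ)

theorem fourthOrder_baseSymbol (α : ℝ) : fourthOrder α (shiftedRe (baseSymbol x) x) (-1) =
    (1 - Real.cos x) ^ 2 * ((2 - α) * ((1 - Real.cos x) * (-8 / 9 - 5 / 18 * Real.cos x))
      + (α - 1) * (-19 / 9 - 1 / 9 * Real.cos x + 11 / 9 * Real.cos x ^ 2)) := by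
  obtain ⟨e1, e2, e0, e1', e2', -, -⟩ := shiftedRe_baseSymbol_values x
  rw [fourthOrder_neg_one, thirdOrder, e1, e2, e1', e2']
  ring

theorem fourthOrder_baseSymbol_sq (α : ℝ) :
    fourthOrder α (shiftedRe (baseSymbol x ^ 2) x) (-1) =
    (1 - Real.cos x) * ((2 - α) * (-7 / 3 + 4 / 3 * Real.cos x - 4 * Real.cos x ^ 2
        + 28 / 9 * Real.cos x ^ 3 + 4 / 9 * Real.cos x ^ 4 - 5 / 9 * Real.cos x ^ 5)
      + (α - 1) * (-11 / 3 + 23 / 3 * Real.cos x - 8 * Real.cos x ^ 2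
        - 28 / 9 * Real.cos x ^ 3 + 68 / 9 * Real.cos x ^ 4 - 22 / 9 * Real.cos x ^ 5)) := by
  obtain ⟨e1, e2, e0, e1', e2'⟩ := shiftedRe_baseSymbol_sq_values x
  rw [fourthOrder_neg_one, thirdOrder, e1, e2, e1', e2']
  ring

theorem centralDiff_baseSymbol :
    centralDiff (shiftedRe (baseSymbol x) x) =
      (1 - Real.cos x) ^ 2 * ((1 - Real.cos x) ^ 2 / 6) := by
  obtain ⟨e1, e2, e0, e1', e2', -, -⟩ := shiftedRe_baseSymbol_values x
  rw [centralDiff, e1, e2, e1', e2', e0]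
  ring

theorem centralDiff_baseSymbol_sq :
    centralDiff (shiftedRe (baseSymbol x ^ 2) x) = (1 - Real.cos x) * ((1 - Real.cos x) ^ 2 *
      (-1 / 2 - 1 / 2 * Real.cos x + Real.cos x ^ 2 - 1 / 3 * Real.cos x ^ 3)) := by
  obtain ⟨e1, e2, e0, e1', e2'⟩ := shiftedRe_baseSymbol_sq_values x
  rw [centralDiff, e1, e2, e1', e2', e0]
  ring

variable {x}

/-- The two regions contain every pair `(α, ν)` arising from the seven exceptional octuples. The
edge `ν = 4 - 13α/6` is attained, and `-9` lies below the limit `-26/3`, as `α` tends to `1`, of the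
most negative `ν`. -/
theorem re_fivePoint_neg {α ν : ℝ} (h1 : -1 < Real.cos x) (h2 : Real.cos x < 1)
    (hαν : 1 ≤ α ∧ α ≤ 3 / 2 ∧ -9 ≤ ν ∧ ν ≤ 4 - 13 * α / 6 ∨
      3 / 2 ≤ α ∧ α ≤ 2 ∧ -5 ≤ ν ∧ ν ≤ 3 / 4) :
    fourthOrder α (shiftedRe (baseSymbol x) x) (-1)
      + ν * centralDiff (shiftedRe (baseSymbol x) x) < 0 := by
  rw [fourthOrder_baseSymbol, centralDiff_baseSymbol]
  generalize Real.cos x = u at *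
  have h3 := mul_pos (sub_pos.2 h1) (sub_pos.2 h2)
  -- After removal of the factor `(1 - u)²` the expression is affine in `(α, ν)`, so only the
  -- vertices of the region need a polynomial inequality in `u`.
  have key : ((1 - u) * (-8 / 9 - 5 / 18 * u) * 2 - (-19 / 9 - 1 / 9 * u + 11 / 9 * u ^ 2))
      + ((-19 / 9 - 1 / 9 * u + 11 / 9 * u ^ 2) - (1 - u) * (-8 / 9 - 5 / 18 * u)) * α
      + (1 - u) ^ 2 / 6 * ν < 0 := by
    rcases hαν with ⟨a0, a1, n0, n1⟩ | ⟨a0, a1, n0, n1⟩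
    · refine affine_neg_of_vertices (q := -13 / 6) (p := 4) a0 a1 (by norm_num) n0 (by linarith)
        ?_ ?_ ?_ ?_ <;> nlinarith
    · refine affine_neg_of_vertices (q := 0) (p := 3 / 4) a0 a1 (by norm_num) n0 (by linarith)
        ?_ ?_ ?_ ?_ <;> nlinarith
  have := mul_neg_of_pos_of_neg (pow_pos (sub_pos.2 h2) 2) key
  linarith

theorem re_sq_fivePoint_nonpos {α ν : ℝ} (h1 : -1 < Real.cos x) (h2 : Real.cos x < 1)
    (hα : 3 / 2 ≤ α) (hα' : α ≤ 2) (hν : -5 ≤ ν) (hν' : ν ≤ 3 / 4) :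
    fourthOrder α (shiftedRe (baseSymbol x ^ 2) x) (-1)
      + ν * centralDiff (shiftedRe (baseSymbol x ^ 2) x) ≤ 0 := by
  rw [fourthOrder_baseSymbol_sq, centralDiff_baseSymbol_sq]
  generalize Real.cos x = u at *
  have h3 := mul_pos (sub_pos.2 h1) (sub_pos.2 h2)
  have key : (2 * (-7 / 3 + 4 / 3 * u - 4 * u ^ 2 + 28 / 9 * u ^ 3 + 4 / 9 * u ^ 4 - 5 / 9 * u ^ 5)
        - (-11 / 3 + 23 / 3 * u - 8 * u ^ 2 - 28 / 9 * u ^ 3 + 68 / 9 * u ^ 4 - 22 / 9 * u ^ 5))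
      + ((-11 / 3 + 23 / 3 * u - 8 * u ^ 2 - 28 / 9 * u ^ 3 + 68 / 9 * u ^ 4 - 22 / 9 * u ^ 5)
        - (-7 / 3 + 4 / 3 * u - 4 * u ^ 2 + 28 / 9 * u ^ 3 + 4 / 9 * u ^ 4 - 5 / 9 * u ^ 5)) * α
      + (1 - u) ^ 2 * (-1 / 2 - 1 / 2 * u + u ^ 2 - 1 / 3 * u ^ 3) * ν ≤ 0 := by
    refine affine_nonpos_of_vertices (q := 0) (p := 3 / 4) hα hα' (by norm_num) hν (by linarith)
      ?_ ?_ ?_ ?_ <;>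
    nlinarith [h3, mul_pos h3 h3, mul_pos h3 (sub_pos.2 h1), mul_pos h3 (sub_pos.2 h2), sq_nonneg u,
      sq_nonneg (u * (1 - u)), sq_nonneg (1 - u),
      mul_nonneg (sub_pos.2 h2).le (sq_nonneg (u * (1 - u))),
      mul_nonneg (sub_pos.2 h2).le (sq_nonneg (u + 1 / 2)),
      mul_nonneg (sub_pos.2 h1).le (sq_nonneg (u - 1 / 2)),
      mul_nonneg (sub_pos.2 h2).le (sq_nonneg (u ^ 2)),
      mul_nonneg (sub_pos.2 h2).le (sq_nonneg u),
      mul_nonneg (sub_pos.2 h1).le (sq_nonneg (u * (1 - u)))]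
  have := mul_nonpos_of_nonneg_of_nonpos (sub_pos.2 h2).le key
  linarith

/-- Replaces `re_sq_fivePoint_nonpos` for small `α`, where the part from `w²` alone may be positive:
with `α = 1`, `ν = -26/3`, `cos x = 0` it equals `2`. -/
theorem re_combination_fivePoint_nonpos {α ν : ℝ} (h1 : -1 < Real.cos x) (h2 : Real.cos x < 1)
    (hα : 1 ≤ α) (hα' : α ≤ 3 / 2) (hν : -9 ≤ ν) (hν' : ν ≤ 4 - 13 * α / 6) :
    2 * (1 - Real.cos x) * (fourthOrder α (shiftedRe (baseSymbol x) x) (-1)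
        + ν * centralDiff (shiftedRe (baseSymbol x) x))
      + (fourthOrder α (shiftedRe (baseSymbol x ^ 2) x) (-1)
        + ν * centralDiff (shiftedRe (baseSymbol x ^ 2) x)) ≤ 0 := by
  rw [fourthOrder_baseSymbol, centralDiff_baseSymbol, fourthOrder_baseSymbol_sq,
    centralDiff_baseSymbol_sq]
  generalize Real.cos x = u at *
  have h3 := mul_pos (sub_pos.2 h1) (sub_pos.2 h2)
  have key : (2 * (2 * (1 - u) ^ 2 * ((1 - u) * (-8 / 9 - 5 / 18 * u))
          + (-7 / 3 + 4 / 3 * u - 4 * u ^ 2 + 28 / 9 * u ^ 3 + 4 / 9 * u ^ 4 - 5 / 9 * u ^ 5))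
        - (2 * (1 - u) ^ 2 * (-19 / 9 - 1 / 9 * u + 11 / 9 * u ^ 2)
          + (-11 / 3 + 23 / 3 * u - 8 * u ^ 2 - 28 / 9 * u ^ 3 + 68 / 9 * u ^ 4 - 22 / 9 * u ^ 5)))
      + ((2 * (1 - u) ^ 2 * (-19 / 9 - 1 / 9 * u + 11 / 9 * u ^ 2)
          + (-11 / 3 + 23 / 3 * u - 8 * u ^ 2 - 28 / 9 * u ^ 3 + 68 / 9 * u ^ 4 - 22 / 9 * u ^ 5))
        - (2 * (1 - u) ^ 2 * ((1 - u) * (-8 / 9 - 5 / 18 * u))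
          + (-7 / 3 + 4 / 3 * u - 4 * u ^ 2 + 28 / 9 * u ^ 3 + 4 / 9 * u ^ 4 - 5 / 9 * u ^ 5))) * α
      + (2 * (1 - u) ^ 2 * ((1 - u) ^ 2 / 6)
        + (1 - u) ^ 2 * (-1 / 2 - 1 / 2 * u + u ^ 2 - 1 / 3 * u ^ 3)) * ν ≤ 0 := by
    refine affine_nonpos_of_vertices (q := -13 / 6) (p := 4) hα hα' (by norm_num) hν (by linarith)
      ?_ ?_ ?_ ?_ <;>
    nlinarith [h3, mul_pos h3 h3, mul_pos h3 (sub_pos.2 h1), mul_pos h3 (sub_pos.2 h2), sq_nonneg u,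
      sq_nonneg (u * (1 - u)), sq_nonneg (1 - u),
      mul_nonneg (sub_pos.2 h2).le (sq_nonneg (u * (1 - u))),
      mul_nonneg (sub_pos.2 h2).le (sq_nonneg (u + 1 / 2)),
      mul_nonneg (sub_pos.2 h1).le (sq_nonneg (u - 1 / 2)),
      mul_nonneg (sub_pos.2 h2).le (sq_nonneg (u ^ 2)),
      mul_nonneg (sub_pos.2 h2).le (sq_nonneg u),
      mul_nonneg (sub_pos.2 h1).le (sq_nonneg (u * (1 - u)))]
  have := mul_nonpos_of_nonneg_of_nonpos (sub_pos.2 h2).le key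
  linarith

end FivePoint

/-! ### Sign of the four-point functionals on the shifts `1, 2, -2, k` with `|k| ≥ 3`. -/

section FourPoint

variable {x : ℝ}

theorem thirdOrder_baseSymbol (x α : ℝ) : thirdOrder α (shiftedRe (baseSymbol x) x) =
    (1 - Real.cos x) ^ 2 * ((2 - α) * (-19 / 9 + 8 / 9 * Real.cos x ^ 2)
      + (α - 1) * (-17 / 9 + 10 / 9 * Real.cos x ^ 2)) := by
  obtain ⟨e1, e2, e0, e1', e2', -, -⟩ := shiftedRe_baseSymbol_values x
  rw [thirdOrder, e1, e2, e2']
  ring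

theorem thirdOrder_baseSymbol_sq (x α : ℝ) : thirdOrder α (shiftedRe (baseSymbol x ^ 2) x) =
    (1 - Real.cos x) * ((2 - α) * (-43 / 9 + 67 / 9 * Real.cos x - 58 / 9 * Real.cos x ^ 2
        - 16 / 9 * Real.cos x ^ 3 + 16 / 3 * Real.cos x ^ 4 - 16 / 9 * Real.cos x ^ 5)
      + (α - 1) * (-29 / 9 + 59 / 9 * Real.cos x - 68 / 9 * Real.cos x ^ 2
        - 20 / 9 * Real.cos x ^ 3 + 20 / 3 * Real.cos x ^ 4 - 20 / 9 * Real.cos x ^ 5)) := by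
  obtain ⟨e1, e2, e0, e1', e2'⟩ := shiftedRe_baseSymbol_sq_values x
  rw [thirdOrder, e1, e2, e2']
  ring

theorem abs_divDiff_baseSymbol_le (x : ℝ) {k : ℤ} (hk : 3 ≤ |k|) :
    |interpRem (shiftedRe (baseSymbol x) x) k / nodePoly k|
      ≤ (1 - Real.cos x) ^ 2 * (7 - 3 * Real.cos x) / 6 := by
  refine (abs_interpRem_div_le (abs_third_difference_shiftedRe_le _ x) hk).trans ?_
  have hE := norm_baseSymbol_sq x
  have hu : 0 ≤ 1 - Real.cos x := sub_nonneg.2 (Real.cos_le_one x)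
  have hr : √(2 - 2 * Real.cos x) ^ 2 = 2 * (1 - Real.cos x) := by
    rw [Real.sq_sqrt (by linarith)]; ring
  -- AM–GM, sharp at `cos x = 1`: with `u = cos x`, `((7 - 3u) / 2)² - 2 (5 - 3u) = 9 (1 - u)² / 4`.
  have h : ‖baseSymbol x‖ * √(2 - 2 * Real.cos x)
      ≤ (1 - Real.cos x) * (7 - 3 * Real.cos x) / 2 := by
    refine abs_le_of_sq_le_sq' ?_ ?_ |>.2
    · rw [mul_pow, hE, hr]
      nlinarith [mul_nonneg (sq_nonneg (1 - Real.cos x)) (sq_nonneg (1 - Real.cos x))]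
    · have := Real.cos_le_one x
      exact div_nonneg (mul_nonneg hu (by linarith)) (by norm_num)
  have e : ‖baseSymbol x‖ * √(2 - 2 * Real.cos x) ^ 3
      = ‖baseSymbol x‖ * √(2 - 2 * Real.cos x) * (2 * (1 - Real.cos x)) := by rw [← hr]; ring
  rw [e]
  nlinarith [mul_le_mul_of_nonneg_right h hu]

/-- The parameter `c` is the point where the AM–GM bound for `√(2 - 2 cos x)` is sharp; it is chosen
according to the range of `cos x` in which the estimate is tight. -/
theorem abs_divDiff_baseSymbol_sq_le (x : ℝ) {k : ℤ} (hk : 3 ≤ |k|) {c : ℝ} (hc : 0 < c) :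
    |interpRem (shiftedRe (baseSymbol x ^ 2) x) k / nodePoly k|
      ≤ (1 - Real.cos x) * ((1 - Real.cos x) * (5 - 3 * Real.cos x) / 3 *
        ((2 - 2 * Real.cos x + c ^ 2) / (2 * c))) := by
  refine (abs_interpRem_div_le (abs_third_difference_shiftedRe_le _ x) hk).trans ?_
  have hu : 0 ≤ 1 - Real.cos x := sub_nonneg.2 (Real.cos_le_one x)
  have hu' : 0 ≤ 5 - 3 * Real.cos x := by linarith
  have hr : √(2 - 2 * Real.cos x) ^ 2 = 2 * (1 - Real.cos x) := by
    rw [Real.sq_sqrt (by linarith)]; ring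
  have h : √(2 - 2 * Real.cos x) ≤ (2 - 2 * Real.cos x + c ^ 2) / (2 * c) := by
    rw [le_div_iff₀ (by linarith)]
    nlinarith [sq_nonneg (√(2 - 2 * Real.cos x) - c)]
  rw [norm_pow, norm_baseSymbol_sq]
  have e : (1 - Real.cos x) * (5 - 3 * Real.cos x) * √(2 - 2 * Real.cos x) ^ 3 / 6
      = (1 - Real.cos x) * ((1 - Real.cos x) * (5 - 3 * Real.cos x) / 3
        * √(2 - 2 * Real.cos x)) := by
    rw [pow_succ, hr]; ring
  rw [e]
  gcongr

/-- Clears the denominator `nodePoly k`, whose sign is that of `k`; the factor `11 / 6` is `4 -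
13α/6` at `α = 1`. -/
theorem fourthOrder_one_nonpos_of_remainder {f : ℤ → ℝ} {k : ℤ} (hk : 3 ≤ |k|)
    (hp : 3 ≤ k → nodePoly k * thirdOrder 1 f + 11 / 6 * interpRem f k ≤ 0)
    (hn : k ≤ -3 → 0 ≤ nodePoly k * thirdOrder 1 f + 11 / 6 * interpRem f k) :
    fourthOrder 1 f k ≤ 0 := by
  have e (h : nodePoly k ≠ 0) : fourthOrder 1 f k
      = (nodePoly k * thirdOrder 1 f + 11 / 6 * interpRem f k) / nodePoly k := by
    rw [fourthOrder]; field_simp; ring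
  rcases le_abs'.1 hk with hk | hk
  · rw [e (nodePoly_neg hk).ne]
    exact div_nonpos_of_nonneg_of_nonpos (hn hk) (nodePoly_neg hk).le
  · rw [e (nodePoly_pos hk).ne']
    exact div_nonpos_of_nonpos_of_nonneg (hp hk) (nodePoly_pos hk).le

theorem re_fourthOrder_two_neg (hx : Real.cos x < 1) {k : ℤ} (hk : 3 ≤ |k|) :
    fourthOrder 2 (shiftedRe (baseSymbol x) x) k < 0 := by
  have h := (abs_le.1 (abs_divDiff_baseSymbol_le x hk)).1
  rw [fourthOrder, thirdOrder_baseSymbol]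
  have h1 := Real.neg_one_le_cos x
  generalize Real.cos x = u at *
  have := mul_neg_of_pos_of_neg (pow_pos (sub_pos.2 hx) 2)
    (show -17 / 9 + 10 / 9 * u ^ 2 + (7 - 3 * u) / 18 < 0 by nlinarith)
  linarith

theorem re_sq_fourthOrder_two_nonpos (x : ℝ) {k : ℤ} (hk : 3 ≤ |k|) :
    fourthOrder 2 (shiftedRe (baseSymbol x ^ 2) x) k ≤ 0 := by
  have h := (abs_le.1 (abs_divDiff_baseSymbol_sq_le x hk two_pos)).1
  rw [fourthOrder, thirdOrder_baseSymbol_sq]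
  have h1 := Real.neg_one_le_cos x
  have h2 := Real.cos_le_one x
  generalize Real.cos x = u at *
  have key : (-29 / 9 + 59 / 9 * u - 68 / 9 * u ^ 2 - 20 / 9 * u ^ 3 + 20 / 3 * u ^ 4
      - 20 / 9 * u ^ 5) + 1 / 3 * ((1 - u) * (5 - 3 * u) / 3 * ((3 - u) / 2)) ≤ 0 := by
    nlinarith [mul_nonneg (sub_nonneg.2 h1) (sub_nonneg.2 h2), sq_nonneg (u * (1 - u)),
      sq_nonneg (1 - u), sq_nonneg u, mul_nonneg (sub_nonneg.2 h2) (sq_nonneg (u * (1 - u))),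
      mul_nonneg (sub_nonneg.2 h2) (sq_nonneg u),
      mul_nonneg (sub_nonneg.2 h2) (sq_nonneg (u - 1 / 4)),
      mul_nonneg (sub_nonneg.2 h1) (sq_nonneg (u * (1 - u)))]
  have := mul_nonpos_of_nonneg_of_nonpos (sub_nonneg.2 h2) key
  linarith

theorem re_fourthOrder_one_nonpos (x : ℝ) {k : ℤ} (hk : 3 ≤ |k|) :
    fourthOrder 1 (shiftedRe (baseSymbol x) x) k ≤ 0 := by
  have h1 := Real.neg_one_le_cos x
  have h2 := Real.cos_le_one x
  -- The divided difference bound leads to `(1 - u) (1 - 32u) / 36`, which is nonpositive exactly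
  -- for `1/32 ≤ u ≤ 1`. For smaller `u` the value at `k` is estimated by `‖baseSymbol x‖` instead.
  rcases le_total (1 / 32) (Real.cos x) with hu | hu
  · have h := (abs_le.1 (abs_divDiff_baseSymbol_le x hk)).2
    rw [fourthOrder, thirdOrder_baseSymbol]
    generalize Real.cos x = u at *
    have := mul_nonpos_of_nonneg_of_nonpos (sq_nonneg (1 - u))
      (show -19 / 9 + 8 / 9 * u ^ 2 + 11 / 36 * (7 - 3 * u) ≤ 0 by nlinarith)
    linarith
  -- Linear majorant of `‖baseSymbol x‖`, sharp at `cos x = -1`.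
  · have hG : |shiftedRe (baseSymbol x) x k| ≤ (9 - 7 * Real.cos x) / 4 := by
      refine (abs_shiftedRe_le _ _ _).trans ?_
      refine abs_le_of_sq_le_sq' ?_ (by linarith) |>.2
      rw [norm_baseSymbol_sq]
      nlinarith [sq_nonneg (1 + Real.cos x)]
    obtain ⟨hG1, hG2⟩ := abs_le.1 hG
    have e := thirdOrder_baseSymbol x 1
    obtain ⟨e1, e2, -, -, e2', -, -⟩ := shiftedRe_baseSymbol_values x
    apply fourthOrder_one_nonpos_of_remainder hk
    · intro hk'
      obtain ⟨t, ht, rfl⟩ : ∃ t : ℤ, 0 ≤ t ∧ k = 3 + t := ⟨k - 3, by omega, by ring⟩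
      have ht' : (0 : ℝ) ≤ t := by exact_mod_cast ht
      rw [interpRem, e, e1, e2, e2', nodePoly]
      generalize Real.cos x = u at *
      generalize shiftedRe (baseSymbol x) x (3 + t) = g at *
      push_cast
      generalize (t : ℝ) = t at *
      -- With `k = 3 + t` and `g` replaced by its bound, the expression is a cubic in `t ≥ 0`; `c0,
      -- …, c3` are the signs of its coefficients.
      have c0 : -437 / 24 + 1259 / 24 * u - 77 / 3 * u ^ 2 - 46 / 3 * u ^ 3
          + 23 / 3 * u ^ 4 ≤ 0 := by
        nlinarith [sq_nonneg u, mul_nonneg (sub_nonneg.2 h1) (sub_nonneg.2 hu),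
          sq_nonneg (u * (u + 1)), mul_nonneg (sub_nonneg.2 h1) (sq_nonneg u)]
      have c1 : -356 / 9 + 745 / 9 * u - 539 / 18 * u ^ 2 - 239 / 9 * u ^ 3 + 239 / 18 * u ^ 4
          ≤ 0 := by
        nlinarith [sq_nonneg u, mul_nonneg (sub_nonneg.2 h1) (sub_nonneg.2 hu),
          sq_nonneg (u * (u + 1)), mul_nonneg (sub_nonneg.2 h1) (sq_nonneg u)]
      have c2 : -35 / 2 + 35 * u - 11 * u ^ 2 - 13 * u ^ 3 + 13 / 2 * u ^ 4 ≤ 0 := by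
        nlinarith [sq_nonneg u, mul_nonneg (sub_nonneg.2 h1) (sub_nonneg.2 hu),
          sq_nonneg (u * (u + 1)), mul_nonneg (sub_nonneg.2 h1) (sq_nonneg u)]
      have c3 : -19 / 9 + 38 / 9 * u - 11 / 9 * u ^ 2 - 16 / 9 * u ^ 3 + 8 / 9 * u ^ 4 ≤ 0 := by
        nlinarith [sq_nonneg u, mul_nonneg (sub_nonneg.2 h1) (sub_nonneg.2 hu),
          sq_nonneg (u * (u + 1)), mul_nonneg (sub_nonneg.2 h1) (sq_nonneg u)]
      linarith [mul_nonneg ht' (neg_nonneg.2 c1), mul_nonneg (pow_nonneg ht' 2) (neg_nonneg.2 c2),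
        mul_nonneg (pow_nonneg ht' 3) (neg_nonneg.2 c3)]
    · intro hk'
      obtain ⟨t, ht, rfl⟩ : ∃ t : ℤ, 0 ≤ t ∧ k = -3 - t := ⟨-3 - k, by omega, by ring⟩
      have ht' : (0 : ℝ) ≤ t := by exact_mod_cast ht
      rw [interpRem, e, e1, e2, e2', nodePoly]
      generalize Real.cos x = u at *
      generalize shiftedRe (baseSymbol x) x (-3 - t) = g at *
      push_cast
      generalize (t : ℝ) = t at *
      have c0 : 0 ≤ 295 / 8 - 2155 / 24 * u + 22 * u ^ 2 + 60 * u ^ 3 - 30 * u ^ 4 := by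
        nlinarith [sq_nonneg u, mul_nonneg (sub_nonneg.2 h1) (sub_nonneg.2 hu),
          sq_nonneg (u * (u + 1)), mul_nonneg (sub_nonneg.2 h1) (sq_nonneg u)]
      have c1 : 0 ≤ 518 / 9 - 1069 / 9 * u + 539 / 18 * u ^ 2 + 563 / 9 * u ^ 3
          - 563 / 18 * u ^ 4 := by
        nlinarith [sq_nonneg u, mul_nonneg (sub_nonneg.2 h1) (sub_nonneg.2 hu),
          sq_nonneg (u * (u + 1)), mul_nonneg (sub_nonneg.2 h1) (sq_nonneg u)]
      have c2 : 0 ≤ 41 / 2 - 41 * u + 11 * u ^ 2 + 19 * u ^ 3 - 19 / 2 * u ^ 4 := by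
        nlinarith [sq_nonneg u, mul_nonneg (sub_nonneg.2 h1) (sub_nonneg.2 hu),
          sq_nonneg (u * (u + 1)), mul_nonneg (sub_nonneg.2 h1) (sq_nonneg u)]
      have c3 : 0 ≤ 19 / 9 - 38 / 9 * u + 11 / 9 * u ^ 2 + 16 / 9 * u ^ 3 - 8 / 9 * u ^ 4 := by
        nlinarith [sq_nonneg u, mul_nonneg (sub_nonneg.2 h1) (sub_nonneg.2 hu),
          sq_nonneg (u * (u + 1)), mul_nonneg (sub_nonneg.2 h1) (sq_nonneg u)]
      linarith [mul_nonneg ht' c1, mul_nonneg (pow_nonneg ht' 2) c2,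
        mul_nonneg (pow_nonneg ht' 3) c3]

/-- These are the coefficients of `t⁰, …, t³` in `nodePoly k * thirdOrder 1 f + 11 / 6 * interpRem f
k` for the squared symbol, with `k = 3 + t` and the value at `k` replaced by its upper bound `(1 -
u) (5 - 3u)`. -/
theorem sq_remainder_coeffs_nonpos {u : ℝ} (h1 : -1 ≤ u) (hu : u ≤ 1 / 32) :
    -131 / 2 + 979 / 6 * u - 947 / 6 * u ^ 2 + 269 / 6 * u ^ 3 + 184 / 3 * u ^ 4 - 184 / 3 * u ^ 5
      + 46 / 3 * u ^ 6 ≤ 0 ∧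
    -962 / 9 + 2299 / 9 * u - 2257 / 9 * u ^ 2 + 227 / 3 * u ^ 3 + 956 / 9 * u ^ 4
      - 956 / 9 * u ^ 5 + 239 / 9 * u ^ 6 ≤ 0 ∧
    -85 / 2 + 209 / 2 * u - 221 / 2 * u ^ 2 + 71 / 2 * u ^ 3 + 52 * u ^ 4 - 52 * u ^ 5
      + 13 * u ^ 6 ≤ 0 ∧
    -43 / 9 + 110 / 9 * u - 125 / 9 * u ^ 2 + 14 / 3 * u ^ 3 + 64 / 9 * u ^ 4 - 64 / 9 * u ^ 5
      + 16 / 9 * u ^ 6 ≤ 0 := by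
  refine ⟨?_, ?_, ?_, ?_⟩ <;>
  nlinarith [sq_nonneg u, mul_nonneg (sub_nonneg.2 h1) (sub_nonneg.2 hu),
    sq_nonneg (u * (u + 1)), mul_nonneg (sub_nonneg.2 h1) (sq_nonneg u),
    mul_nonneg (sub_nonneg.2 h1) (sq_nonneg (u ^ 2)), sq_nonneg (u ^ 2 * (u + 1)),
    mul_nonneg (sub_nonneg.2 hu) (sq_nonneg u),
    mul_nonneg (sub_nonneg.2 hu) (sq_nonneg (u ^ 2))]

/-- The same coefficients for `k = -3 - t`, with the value at `k` replaced by its lower bound. -/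
theorem sq_remainder_coeffs_nonneg {u : ℝ} (h1 : -1 ≤ u) (hu : u ≤ 1 / 32) :
    0 ≤ 119 / 2 - 1309 / 6 * u + 2147 / 6 * u ^ 2 - 835 / 6 * u ^ 3 - 240 * u ^ 4 + 240 * u ^ 5
        - 60 * u ^ 6 ∧
    0 ≤ 1016 / 9 - 2893 / 9 * u + 3823 / 9 * u ^ 2 - 461 / 3 * u ^ 3 - 2252 / 9 * u ^ 4
        + 2252 / 9 * u ^ 5 - 563 / 9 * u ^ 6 ∧
    0 ≤ 87 / 2 - 231 / 2 * u + 279 / 2 * u ^ 2 - 97 / 2 * u ^ 3 - 76 * u ^ 4 + 76 * u ^ 5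
        - 19 * u ^ 6 ∧
    0 ≤ 43 / 9 - 110 / 9 * u + 125 / 9 * u ^ 2 - 14 / 3 * u ^ 3 - 64 / 9 * u ^ 4 + 64 / 9 * u ^ 5
        - 16 / 9 * u ^ 6 := by
  refine ⟨?_, ?_, ?_, ?_⟩ <;>
  nlinarith [sq_nonneg u, mul_nonneg (sub_nonneg.2 h1) (sub_nonneg.2 hu),
    sq_nonneg (u * (u + 1)), mul_nonneg (sub_nonneg.2 h1) (sq_nonneg u),
    mul_nonneg (sub_nonneg.2 h1) (sq_nonneg (u ^ 2)), sq_nonneg (u ^ 2 * (u + 1)),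
    mul_nonneg (sub_nonneg.2 hu) (sq_nonneg u),
    mul_nonneg (sub_nonneg.2 hu) (sq_nonneg (u ^ 2))]

theorem re_sq_fourthOrder_one_nonpos (x : ℝ) {k : ℤ} (hk : 3 ≤ |k|) :
    fourthOrder 1 (shiftedRe (baseSymbol x ^ 2) x) k ≤ 0 := by
  have h1 := Real.neg_one_le_cos x
  have h2 := Real.cos_le_one x
  rcases le_total (1 / 32) (Real.cos x) with hu | hu
  · have h := (abs_le.1 (abs_divDiff_baseSymbol_sq_le x hk (c := 5 / 4) (by norm_num))).2
    rw [show (2 * (5 / 4) : ℝ) = 5 / 2 by norm_num,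
      show ((5 / 4) ^ 2 : ℝ) = 25 / 16 by norm_num] at h
    rw [fourthOrder, thirdOrder_baseSymbol_sq]
    generalize Real.cos x = u at *
    have key : (-43 / 9 + 67 / 9 * u - 58 / 9 * u ^ 2 - 16 / 9 * u ^ 3 + 16 / 3 * u ^ 4
        - 16 / 9 * u ^ 5)
        + 11 / 6 * ((1 - u) * (5 - 3 * u) / 3 * ((2 - 2 * u + 25 / 16) / (5 / 2))) ≤ 0 := by
      nlinarith [mul_nonneg (sub_nonneg.2 hu) (sub_nonneg.2 h2), sq_nonneg (u * (1 - u)),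
        sq_nonneg (1 - u), sq_nonneg u, mul_nonneg (sub_nonneg.2 h2) (sq_nonneg (u * (1 - u))),
        mul_nonneg (sub_nonneg.2 h2) (sq_nonneg u),
        mul_nonneg (sub_nonneg.2 h2) (sq_nonneg (u - 1 / 4))]
    have := mul_nonpos_of_nonneg_of_nonpos (sub_nonneg.2 h2) key
    linarith
  · have hG : |shiftedRe (baseSymbol x ^ 2) x k| ≤ (1 - Real.cos x) * (5 - 3 * Real.cos x) := by
      refine (abs_shiftedRe_le _ _ _).trans ?_
      rw [norm_pow, norm_baseSymbol_sq]
    obtain ⟨hG1, hG2⟩ := abs_le.1 hG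
    have e := thirdOrder_baseSymbol_sq x 1
    obtain ⟨e1, e2, -, -, e2'⟩ := shiftedRe_baseSymbol_sq_values x
    apply fourthOrder_one_nonpos_of_remainder hk
    · intro hk'
      obtain ⟨t, ht, rfl⟩ : ∃ t : ℤ, 0 ≤ t ∧ k = 3 + t := ⟨k - 3, by omega, by ring⟩
      have ht' : (0 : ℝ) ≤ t := by exact_mod_cast ht
      rw [interpRem, e, e1, e2, e2', nodePoly]
      generalize Real.cos x = u at *
      generalize shiftedRe (baseSymbol x ^ 2) x (3 + t) = g at *
      push_cast
      generalize (t : ℝ) = t at *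
      obtain ⟨c0, c1, c2, c3⟩ := sq_remainder_coeffs_nonpos h1 hu
      linarith [mul_nonneg ht' (neg_nonneg.2 c1), mul_nonneg (pow_nonneg ht' 2) (neg_nonneg.2 c2),
        mul_nonneg (pow_nonneg ht' 3) (neg_nonneg.2 c3)]
    · intro hk'
      obtain ⟨t, ht, rfl⟩ : ∃ t : ℤ, 0 ≤ t ∧ k = -3 - t := ⟨-3 - k, by omega, by ring⟩
      have ht' : (0 : ℝ) ≤ t := by exact_mod_cast ht
      rw [interpRem, e, e1, e2, e2', nodePoly]
      generalize Real.cos x = u at *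
      generalize shiftedRe (baseSymbol x ^ 2) x (-3 - t) = g at *
      push_cast
      generalize (t : ℝ) = t at *
      obtain ⟨c0, c1, c2, c3⟩ := sq_remainder_coeffs_nonneg h1 hu
      linarith [mul_nonneg ht' c1, mul_nonneg (pow_nonneg ht' 2) c2,
        mul_nonneg (pow_nonneg ht' 3) c3]

theorem re_fourthOrder_neg (hx : Real.cos x < 1) {α : ℝ} (hα : 1 < α) (hα' : α ≤ 2) {k : ℤ}
    (hk : 3 ≤ |k|) : fourthOrder α (shiftedRe (baseSymbol x) x) k < 0 := by
  rw [fourthOrder_affine]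
  have h1 := mul_nonpos_of_nonneg_of_nonpos (sub_nonneg.2 hα') (re_fourthOrder_one_nonpos x hk)
  have h2 := mul_neg_of_pos_of_neg (sub_pos.2 hα) (re_fourthOrder_two_neg hx hk)
  linarith

theorem re_sq_fourthOrder_nonpos {α : ℝ} (hα : 1 ≤ α) (hα' : α ≤ 2) {k : ℤ} (hk : 3 ≤ |k|) :
    fourthOrder α (shiftedRe (baseSymbol x ^ 2) x) k ≤ 0 := by
  rw [fourthOrder_affine]
  have h1 := mul_nonpos_of_nonneg_of_nonpos (sub_nonneg.2 hα') (re_sq_fourthOrder_one_nonpos x hk)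
  have h2 := mul_nonpos_of_nonneg_of_nonpos (sub_nonneg.2 hα) (re_sq_fourthOrder_two_nonpos x hk)
  linarith

end FourPoint

/-! ### Reduction of the effective octuples to the normal forms. -/

/-- The weights of `wsldMatrix₂` applied to the values of a function at the shifts. -/
noncomputable def wsldSum₂ (f : ℤ → ℝ) (p q : ℤ) : ℝ := weight₂ p q * f p + weight₂ q p * f q

/-- The weights of `wsldMatrix₃` applied to the values of a function at the shifts. -/
noncomputable def wsldSum₃ (α : ℝ) (f : ℤ → ℝ) (p q r s : ℤ) : ℝ :=
  weight₃ α p q r s * wsldSum₂ f p q + weight₃ α r s p q * wsldSum₂ f r s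

namespace WSLDShifts

/-- The weights of `WSLDShifts.matrix` applied to the values of a function at the shifts. -/
noncomputable def sum (S : WSLDShifts) (α : ℝ) (f : ℤ → ℝ) : ℝ :=
  S.weight₄ α * wsldSum₃ α f S.p S.q S.r S.s + S.weight₄' α * wsldSum₃ α f S.p' S.q' S.r' S.s'

theorem weight₄_eq_div {S : WSLDShifts} {α c n n' d : ℝ} (hc : c ≠ 0)
    (h : aConst S.p S.q S.r S.s * bConst α S.p' S.q' S.r' S.s' = c * n)
    (h' : aConst S.p' S.q' S.r' S.s' * bConst α S.p S.q S.r S.s = -(c * n')) (hd : n + n' = d) :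
    S.weight₄ α = n / d ∧ S.weight₄' α = n' / d := by
  rw [weight₄, weight₄', h, h', ← hd]
  constructor
  · rw [show c * n - -(c * n') = c * (n + n') by ring, mul_div_mul_left _ _ hc]
  · rw [show -(c * n') - c * n = -c * (n + n') by ring, show -(c * n') = -c * n' by ring,
      mul_div_mul_left _ _ (neg_ne_zero.2 hc)]

/-- Two five-point functionals with the same moments up to order three differ by a multiple of the
fourth difference. This and the next six identities compute that multiple; it vanishes when the
shift `0` does not occur. -/
theorem sum_fivePoint₁ {α : ℝ} (h1 : 1 < α) (f : ℤ → ℝ) :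
    sum ⟨1, 2, 1, 0, 1, 2, 1, -2⟩ α f = fourthOrder α f (-1)
      + (4 - 13 * α / 6) * centralDiff f := by
  have hd : 24 + 8 * α ≠ 0 := fun h => by linarith
  obtain ⟨e, e'⟩ := weight₄_eq_div (S := ⟨1, 2, 1, 0, 1, 2, 1, -2⟩) (α := α) (c := -8)
    (n := 24 - 13 * α) (n' := 21 * α) (d := 24 + 8 * α) (by norm_num)
    (by simp only [aConst, bConst]; push_cast; ring)
    (by simp only [aConst, bConst]; push_cast; ring) (by ring)
  rw [fourthOrder_neg_one, sum, e, e']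
  simp only [wsldSum₃, wsldSum₂, weight₃, weight₂, thirdOrder, centralDiff]
  push_cast
  -- The denominator stays atomic while fractions are cleared.
  generalize hd' : 24 + 8 * α = d at *
  field_simp
  subst hd'
  ring

theorem sum_fivePoint₂ {α : ℝ} (h1 : 1 < α) (f : ℤ → ℝ) :
    sum ⟨1, 2, 1, 0, 1, -1, 1, -2⟩ α f = fourthOrder α f (-1)
      + 4 * (1 + α / 3) * (12 + α) / (12 - 20 * α) * centralDiff f := by
  have hd : 12 - 20 * α ≠ 0 := fun h => by linarith
  obtain ⟨e, e'⟩ := weight₄_eq_div (S := ⟨1, 2, 1, 0, 1, -1, 1, -2⟩) (α := α) (c := 2)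
    (n := 12 + α) (n' := -21 * α) (d := 12 - 20 * α) (by norm_num)
    (by simp only [aConst, bConst]; push_cast; ring)
    (by simp only [aConst, bConst]; push_cast; ring) (by ring)
  rw [fourthOrder_neg_one, sum, e, e']
  simp only [wsldSum₃, wsldSum₂, weight₃, weight₂, thirdOrder, centralDiff]
  push_cast
  generalize hd' : 12 - 20 * α = d at *
  field_simp
  subst hd'
  ring

theorem sum_fivePoint₃ {α : ℝ} (h1 : 1 < α) (f : ℤ → ℝ) :
    sum ⟨1, 2, 1, -1, 1, 2, 1, -2⟩ α f = fourthOrder α f (-1) := by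
  have hd : 12 + 4 * α ≠ 0 := fun h => by linarith
  obtain ⟨e, e'⟩ := weight₄_eq_div (S := ⟨1, 2, 1, -1, 1, 2, 1, -2⟩) (α := α) (c := -12)
    (n := 24 - 13 * α) (n' := 17 * α - 12) (d := 12 + 4 * α) (by norm_num)
    (by simp only [aConst, bConst]; push_cast; ring)
    (by simp only [aConst, bConst]; push_cast; ring) (by ring)
  rw [fourthOrder_neg_one, sum, e, e']
  simp only [wsldSum₃, wsldSum₂, weight₃, weight₂, thirdOrder]
  push_cast
  generalize hd' : 12 + 4 * α = d at *
  field_simp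
  subst hd'
  ring

theorem sum_fivePoint₄ {α : ℝ} (h1 : α ≠ 3 / 2) (f : ℤ → ℝ) :
    sum ⟨1, 2, 1, -1, 1, -1, 1, -2⟩ α f = fourthOrder α f (-1) := by
  have hd : 24 - 16 * α ≠ 0 := fun h => by exact h1 (by linarith)
  obtain ⟨e, e'⟩ := weight₄_eq_div (S := ⟨1, 2, 1, -1, 1, -1, 1, -2⟩) (α := α) (c := 3)
    (n := 12 + α) (n' := 12 - 17 * α) (d := 24 - 16 * α) (by norm_num)
    (by simp only [aConst, bConst]; push_cast; ring)
    (by simp only [aConst, bConst]; push_cast; ring) (by ring)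
  rw [fourthOrder_neg_one, sum, e, e']
  simp only [wsldSum₃, wsldSum₂, weight₃, weight₂, thirdOrder]
  push_cast
  generalize hd' : 24 - 16 * α = d at *
  field_simp
  subst hd'
  ring

theorem sum_fivePoint₅ {α : ℝ} (h1 : α < 2) (f : ℤ → ℝ) :
    sum ⟨1, 0, 1, -1, 1, 2, 1, -2⟩ α f = fourthOrder α f (-1)
      + 4 * (1 - 2 * α / 3) * (13 * α - 24) / (4 * α - 24) * centralDiff f := by
  have hd : 4 * α - 24 ≠ 0 := fun h => by linarith
  obtain ⟨e, e'⟩ := weight₄_eq_div (S := ⟨1, 0, 1, -1, 1, 2, 1, -2⟩) (α := α) (c := 4)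
    (n := 13 * α - 24) (n' := -9 * α) (d := 4 * α - 24) (by norm_num)
    (by simp only [aConst, bConst]; push_cast; ring)
    (by simp only [aConst, bConst]; push_cast; ring) (by ring)
  rw [fourthOrder_neg_one, sum, e, e']
  simp only [wsldSum₃, wsldSum₂, weight₃, weight₂, thirdOrder, centralDiff]
  push_cast
  generalize hd' : 4 * α - 24 = d at *
  field_simp
  subst hd'
  ring

theorem sum_fivePoint₆ {α : ℝ} (h1 : α < 2) (f : ℤ → ℝ) :
    sum ⟨1, 0, 1, -2, 1, 2, 1, -2⟩ α f = fourthOrder α f (-1)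
      + (4 - 13 * α / 6) * centralDiff f := by
  have hd : 8 * α - 24 ≠ 0 := fun h => by linarith
  obtain ⟨e, e'⟩ := weight₄_eq_div (S := ⟨1, 0, 1, -2, 1, 2, 1, -2⟩) (α := α) (c := 8)
    (n := 13 * α - 24) (n' := -5 * α) (d := 8 * α - 24) (by norm_num)
    (by simp only [aConst, bConst]; push_cast; ring)
    (by simp only [aConst, bConst]; push_cast; ring) (by ring)
  rw [fourthOrder_neg_one, sum, e, e']
  simp only [wsldSum₃, wsldSum₂, weight₃, weight₂, thirdOrder, centralDiff]
  push_cast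
  generalize hd' : 8 * α - 24 = d at *
  field_simp
  subst hd'
  ring

theorem sum_fivePoint₇ {α : ℝ} (h1 : α < 2) (f : ℤ → ℝ) :
    sum ⟨1, -1, 1, -2, 1, 2, 1, -2⟩ α f = fourthOrder α f (-1) := by
  have hd : 12 * α - 36 ≠ 0 := fun h => by linarith
  obtain ⟨e, e'⟩ := weight₄_eq_div (S := ⟨1, -1, 1, -2, 1, 2, 1, -2⟩) (α := α) (c := 4)
    (n := 13 * α - 24) (n' := -12 - α) (d := 12 * α - 36) (by norm_num)
    (by simp only [aConst, bConst]; push_cast; ring)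
    (by simp only [aConst, bConst]; push_cast; ring) (by ring)
  rw [fourthOrder_neg_one, sum, e, e']
  simp only [wsldSum₃, wsldSum₂, weight₃, weight₂, thirdOrder]
  push_cast
  generalize hd' : 12 * α - 36 = d at *
  field_simp
  subst hd'
  ring

end WSLDShifts

theorem wsldSum₃_one_two_one_neg_two (α : ℝ) (f : ℤ → ℝ) :
    wsldSum₃ α f 1 2 1 (-2) = thirdOrder α f := by
  simp only [wsldSum₃, wsldSum₂, weight₃, weight₂, thirdOrder]
  push_cast
  ring

/-- Splitting `f` into its quadratic interpolant and the remainder: all third order operators agree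
on the interpolant, and the remainder vanishes at the shift `1`. -/
theorem wsldSum₃_one_one (α : ℝ) (f : ℤ → ℝ) {q s : ℤ} (hq : q ≠ 1) (hs : s ≠ 1) (hqs : q ≠ s) :
    wsldSum₃ α f 1 q 1 s = thirdOrder α f
      + (2 * α / 3 + s) / (((q : ℝ) - 1) * (q - s)) * interpRem f q
      + (2 * α / 3 + q) / (((s : ℝ) - 1) * (s - q)) * interpRem f s := by
  have e1 : (q : ℝ) - 1 ≠ 0 := sub_ne_zero.2 (by exact_mod_cast hq)
  have e2 : (s : ℝ) - 1 ≠ 0 := sub_ne_zero.2 (by exact_mod_cast hs)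
  have e3 : (q : ℝ) - s ≠ 0 := sub_ne_zero.2 (by exact_mod_cast hqs)
  have e4 : (s : ℝ) - q ≠ 0 := sub_ne_zero.2 (by exact_mod_cast hqs.symm)
  have e5 : 1 - (q : ℝ) ≠ 0 := sub_ne_zero.2 (by exact_mod_cast hq.symm)
  have e6 : 1 - (s : ℝ) ≠ 0 := sub_ne_zero.2 (by exact_mod_cast hs.symm)
  simp only [wsldSum₃, wsldSum₂, weight₃, weight₂, thirdOrder, interpRem]
  push_cast
  simp only [one_mul]
  field_simp
  ring

theorem interpRem_eq_zero (f : ℤ → ℝ) {k : ℤ} (hk : k = 2 ∨ k = -2) :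
    interpRem f k = 0 ∧ nodePoly k = 0 := by
  rcases hk with rfl | rfl <;> norm_num [interpRem, nodePoly]

/-- The family of effective octuples gives averages of the fourth order combinations. -/
theorem WSLDShifts.exists_sum_family {α : ℝ} (h1 : 1 < α) (h2 : α < 2) {q s : ℤ} (hq : 2 ≤ |q|)
    (hs : 2 ≤ |s|) (hqs : q * s < 0)
    (hadm : Admissible ⟨1, 2, 1, -2, 1, q, 1, s⟩ α) :
    ∃ c d : ℝ, 0 ≤ c ∧ 0 ≤ d ∧ c + d = 1 ∧ (c ≠ 0 → 3 ≤ |q|) ∧ (d ≠ 0 → 3 ≤ |s|) ∧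
      ∀ f, sum ⟨1, 2, 1, -2, 1, q, 1, s⟩ α f = c * fourthOrder α f q + d * fourthOrder α f s := by
  have hM : 0 < 2 * α / 3 := by positivity
  have hM' : 2 * α / 3 < 2 := by linarith
  have hq' : 0 ≤ (q : ℝ) ^ 2 - 4 := by
    have : (2 : ℝ) ≤ |(q : ℝ)| := by exact_mod_cast hq
    nlinarith [sq_abs (q : ℝ)]
  have hs' : 0 ≤ (s : ℝ) ^ 2 - 4 := by
    have : (2 : ℝ) ≤ |(s : ℝ)| := by exact_mod_cast hs
    nlinarith [sq_abs (s : ℝ)]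
  have hq1 : q ≠ 1 := by rintro rfl; norm_num at hq
  have hs1 : s ≠ 1 := by rintro rfl; norm_num at hs
  have hqs' : q ≠ s := by rintro rfl; nlinarith [mul_self_nonneg q]
  have e1 : (q : ℝ) - 1 ≠ 0 := sub_ne_zero.2 (by exact_mod_cast hq1)
  have e2 : (s : ℝ) - 1 ≠ 0 := sub_ne_zero.2 (by exact_mod_cast hs1)
  have e3 : (q : ℝ) - s ≠ 0 := sub_ne_zero.2 (by exact_mod_cast hqs')
  have e4 : (s : ℝ) - q ≠ 0 := sub_ne_zero.2 (by exact_mod_cast hqs'.symm)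
  -- Up to the factor `24 (q - s)`, `N` is the denominator of the weights, hence nonzero by
  -- admissibility. `A / N` and `B / N` will be the coefficients at `q` and `s`.
  set N : ℝ := 2 * α / 3 * (q + s) + q * s + 4 with hN
  set m : ℝ := 4 - 13 * α / 6 with hm
  set A : ℝ := (2 * α / 3 + s) * (q ^ 2 - 4) / (q - s) with hA
  set B : ℝ := (2 * α / 3 + q) * (s ^ 2 - 4) / (s - q) with hB
  have hc : 24 * ((q : ℝ) - s) ≠ 0 := mul_ne_zero (by norm_num) e3
  have h : aConst 1 2 1 (-2) * bConst α 1 q 1 s = 24 * ((q : ℝ) - s) * (N - m) := by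
    simp only [aConst, bConst, hN, hm]; push_cast; ring
  have h' : aConst 1 q 1 s * bConst α 1 2 1 (-2) = -(24 * ((q : ℝ) - s) * m) := by
    simp only [aConst, bConst, hm]; push_cast; ring
  have hN0 : N ≠ 0 := by
    intro h0
    apply hadm.2.2.2.2.2.2
    simp only
    rw [h, h', h0]
    ring
  obtain ⟨w, w'⟩ := weight₄_eq_div (S := ⟨1, 2, 1, -2, 1, q, 1, s⟩) hc h h' (sub_add_cancel N m)
  have hAB : A + B = N := by
    rw [hA, hB, hN, ← neg_sub (q : ℝ) s, div_neg, ← sub_eq_add_neg, ← sub_div,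
      div_eq_iff e3]
    ring
  -- Opposite signs of `q` and `s` enter here, with `0 < 2α/3 < 2 ≤ |q|, |s|`: `A`, `B` and `N = A +
  -- B` then have a common sign, so the combination is convex.
  have hAB' : A ≤ 0 ∧ B ≤ 0 := by
    rcases mul_neg_iff.1 hqs with ⟨a, b⟩ | ⟨a, b⟩
    · rw [abs_of_pos a] at hq
      rw [abs_of_neg b] at hs
      have a' : (2 : ℝ) ≤ q := by exact_mod_cast hq
      have b' : (s : ℝ) ≤ -2 := by exact_mod_cast (by omega : s ≤ -2)
      exact ⟨div_nonpos_of_nonpos_of_nonneg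
          (mul_nonpos_of_nonpos_of_nonneg (by linarith) hq') (by linarith),
        div_nonpos_of_nonneg_of_nonpos (mul_nonneg (by linarith) hs') (by linarith)⟩
    · rw [abs_of_neg a] at hq
      rw [abs_of_pos b] at hs
      have a' : (2 : ℝ) ≤ s := by exact_mod_cast hs
      have b' : (q : ℝ) ≤ -2 := by exact_mod_cast (by omega : q ≤ -2)
      exact ⟨div_nonpos_of_nonneg_of_nonpos (mul_nonneg (by linarith) hq') (by linarith),
        div_nonpos_of_nonpos_of_nonneg
          (mul_nonpos_of_nonpos_of_nonneg (by linarith) hs') (by linarith)⟩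
  have hNneg : N ≤ 0 := by linarith
  have two_or {k : ℤ} (hk : 2 ≤ |k|) (hk' : ¬ 3 ≤ |k|) : k = 2 ∨ k = -2 := by
    rcases abs_cases k with h | h <;> omega
  have term {k : ℤ} {C a : ℝ} (hk : 2 ≤ |k|) (hC : C = a * nodePoly k) (f : ℤ → ℝ) :
      C / N * (m * (interpRem f k / nodePoly k)) = m / N * (a * interpRem f k) := by
    by_cases hk' : 3 ≤ |k|
    · have h : nodePoly k ≠ 0 := by
        rcases le_abs'.1 hk' with hk | hk
        exacts [(nodePoly_neg hk).ne, (nodePoly_pos hk).ne']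
      rw [hC]; field_simp
    · simp [interpRem_eq_zero f (two_or hk hk')]
  have hA' : A = (2 * α / 3 + s) / (((q : ℝ) - 1) * (q - s)) * nodePoly q := by
    rw [hA, nodePoly]; field_simp
  have hB' : B = (2 * α / 3 + q) / (((s : ℝ) - 1) * (s - q)) * nodePoly s := by
    rw [hB, nodePoly]; field_simp
  refine ⟨A / N, B / N, div_nonneg_of_nonpos hAB'.1 hNneg, div_nonneg_of_nonpos hAB'.2 hNneg,
    by rw [← add_div, hAB, div_self hN0], fun h => ?_, fun h => ?_, fun f => ?_⟩
  · by_contra hk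
    exact h (by rw [hA', (interpRem_eq_zero (fun _ => 0) (two_or hq hk)).2]; simp)
  · by_contra hk
    exact h (by rw [hB', (interpRem_eq_zero (fun _ => 0) (two_or hs hk)).2]; simp)
  · rw [sum, w, w', wsldSum₃_one_two_one_neg_two, wsldSum₃_one_one α f hq1 hs1 hqs', fourthOrder,
      fourthOrder, ← hm]
    have : (N - m) / N = A / N + B / N - m / N := by rw [← add_div, hAB, sub_div]
    linear_combination thirdOrder α f * this - term hq hA' f - term hs hB' f

/-- The real parts which control the sign of the symbol of the fourth order operators. -/
theorem WSLDShifts.sum_baseSymbol_neg {S : WSLDShifts} {α : ℝ} (hS : S.Effective)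
    (hadm : S.Admissible α) (h1 : 1 < α) (h2 : α < 2) {x : ℝ} (hx : -1 < Real.cos x)
    (hx' : Real.cos x < 1) :
    S.sum α (shiftedRe (baseSymbol x) x) < 0 ∧
      (S.sum α (shiftedRe (baseSymbol x ^ 2) x) ≤ 0 ∨ α ≤ 3 / 2 ∧
        2 * (1 - Real.cos x) * S.sum α (shiftedRe (baseSymbol x) x)
          + S.sum α (shiftedRe (baseSymbol x ^ 2) x) ≤ 0) := by
  have five {ν : ℝ} (hS : ∀ f, S.sum α f = fourthOrder α f (-1) + ν * centralDiff f)
      (hν : α ≤ 3 / 2 ∧ -9 ≤ ν ∧ ν ≤ 4 - 13 * α / 6 ∨ 3 / 2 ≤ α ∧ -5 ≤ ν ∧ ν ≤ 3 / 4) :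
      S.sum α (shiftedRe (baseSymbol x) x) < 0 ∧
      (S.sum α (shiftedRe (baseSymbol x ^ 2) x) ≤ 0 ∨ α ≤ 3 / 2 ∧
        2 * (1 - Real.cos x) * S.sum α (shiftedRe (baseSymbol x) x)
          + S.sum α (shiftedRe (baseSymbol x ^ 2) x) ≤ 0) := by
    rw [hS, hS]
    rcases hν with ⟨a, b, c⟩ | ⟨a, b, c⟩
    · exact ⟨re_fivePoint_neg hx hx' (.inl ⟨h1.le, a, b, c⟩),
        .inr ⟨a, re_combination_fivePoint_nonpos hx hx' h1.le a b c⟩⟩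
    · exact ⟨re_fivePoint_neg hx hx' (.inr ⟨a, h2.le, b, c⟩),
        .inl (re_sq_fivePoint_nonpos hx hx' a h2.le b c)⟩
  rcases hS with ⟨q, s, hq, hs, -, hqs, rfl⟩ | rfl | rfl | rfl | rfl | rfl | rfl | rfl
  · obtain ⟨c, d, hc, hd, hcd, hcq, hds, h⟩ := exists_sum_family h1 h2 hq hs hqs hadm
    rw [h, h]
    have h_neg {c : ℝ} {k : ℤ} (hc : 0 ≤ c) (hk : c ≠ 0 → 3 ≤ |k|) :
        (c * fourthOrder α (shiftedRe (baseSymbol x) x) k ≤ 0 ∧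
          c * fourthOrder α (shiftedRe (baseSymbol x ^ 2) x) k ≤ 0) ∧
        (c ≠ 0 → c * fourthOrder α (shiftedRe (baseSymbol x) x) k < 0) := by
      rcases hc.eq_or_lt with rfl | hc'
      · simp
      · have hk := hk hc'.ne'
        have a := mul_neg_of_pos_of_neg hc' (re_fourthOrder_neg hx' h1 h2.le hk)
        exact ⟨⟨a.le, mul_nonpos_of_nonneg_of_nonpos hc
          (re_sq_fourthOrder_nonpos h1.le h2.le hk)⟩, fun _ => a⟩
    obtain ⟨⟨a1, a2⟩, a3⟩ := h_neg hc hcq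
    obtain ⟨⟨b1, b2⟩, b3⟩ := h_neg hd hds
    refine ⟨?_, .inl (add_nonpos a2 b2)⟩
    by_cases hc0 : c = 0
    · have := b3 (by rintro rfl; simp [hc0] at hcd)
      linarith
    · have := a3 hc0
      linarith
  · refine five (sum_fivePoint₁ h1) ?_
    rcases le_total α (3 / 2) with h | h
    · exact .inl ⟨h, by linarith, le_rfl⟩
    · exact .inr ⟨h, by linarith, by linarith⟩
  · refine five (sum_fivePoint₂ h1) ?_
    have hd : 12 - 20 * α < 0 := by linarith
    rcases le_total α (3 / 2) with h | h
    · refine .inl ⟨h, ?_, ?_⟩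
      · rw [le_div_iff_of_neg hd]; nlinarith
      · rw [div_le_iff_of_neg hd]; nlinarith
    · refine .inr ⟨h, ?_, ?_⟩
      · rw [le_div_iff_of_neg hd]; nlinarith
      · rw [div_le_iff_of_neg hd]; nlinarith
  · refine five (ν := 0) (fun f => by rw [sum_fivePoint₃ h1]; ring) ?_
    rcases le_total α (3 / 2) with h | h
    · exact .inl ⟨h, by linarith, by linarith⟩
    · exact .inr ⟨h, by linarith, by linarith⟩
  -- Here the denominator is a multiple of `24 - 16α`, and admissibility excludes its zero.
  · have hne : α ≠ 3 / 2 := by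
      rintro rfl
      apply hadm.2.2.2.2.2.2
      norm_num [aConst, bConst]
    refine five (ν := 0) (fun f => by rw [sum_fivePoint₄ hne]; ring) ?_
    rcases le_total α (3 / 2) with h | h
    · exact .inl ⟨h, by linarith, by linarith⟩
    · exact .inr ⟨h, by linarith, by linarith⟩
  · refine five (sum_fivePoint₅ h2) ?_
    have hd : 4 * α - 24 < 0 := by linarith
    rcases le_total α (3 / 2) with h | h
    · refine .inl ⟨h, ?_, ?_⟩
      · rw [le_div_iff_of_neg hd]; nlinarith
      · rw [div_le_iff_of_neg hd]; nlinarith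
    · refine .inr ⟨h, ?_, ?_⟩
      · rw [le_div_iff_of_neg hd]; nlinarith
      · rw [div_le_iff_of_neg hd]; nlinarith
  · refine five (sum_fivePoint₆ h2) ?_
    rcases le_total α (3 / 2) with h | h
    · exact .inl ⟨h, by linarith, le_rfl⟩
    · exact .inr ⟨h, by linarith, by linarith⟩
  · refine five (ν := 0) (fun f => by rw [sum_fivePoint₇ h2]; ring) ?_
    rcases le_total α (3 / 2) with h | h
    · exact .inl ⟨h, by linarith, by linarith⟩
    · exact .inr ⟨h, by linarith, by linarith⟩

/-! ### The coefficients `q_k` as Fourier coefficients of `w^α`. -/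

/-- The generating function of the coefficients `qCoeff α`. -/
noncomputable def powerSymbol (α : ℝ) (z : ℂ) : ℂ :=
  ((3 / 2 : ℝ) ^ α : ℝ) * ((1 - z / 3) ^ (α : ℂ) * (1 - z) ^ (α : ℂ))

theorem hasSum_gCoeff (α : ℝ) {z : ℂ} (hz : ‖z‖ < 1) :
    HasSum (fun k => (gCoeff α k : ℂ) * z ^ k) ((1 - z) ^ (α : ℂ)) := by
  have h := (Complex.one_add_cpow_hasFPowerSeriesOnBall_zero (a := (α : ℂ))).hasSum
    (y := -z) (by simpa [enorm_eq_nnnorm] using! hz)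
  rw [zero_add, ← sub_eq_add_neg] at h
  have e (k : ℕ) : (gCoeff α k : ℂ) * z ^ k = binomialSeries ℂ (α : ℂ) k fun _ => -z := by
    rw [binomialSeries_apply, gCoeff]
    push_cast
    rw [List.ofFn_const, List.prod_replicate, smul_eq_mul, neg_pow z]
    ring
  simp_rw [e]
  exact h

theorem hasSum_qCoeffNat (α : ℝ) {z : ℂ} (hz : ‖z‖ < 1) :
    HasSum (fun k => (qCoeffNat α k : ℂ) * z ^ k) (powerSymbol α z) := by
  have h1 := hasSum_gCoeff α hz
  have hz' : ‖z / 3‖ < 1 := by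
    rw [norm_div, Complex.norm_ofNat]; linarith [norm_nonneg z]
  have h2 := hasSum_gCoeff α hz'
  have h := hasSum_sum_range_mul_of_summable_norm h2.summable.norm h1.summable.norm
  rw [h1.tsum_eq, h2.tsum_eq] at h
  have e (k : ℕ) : (qCoeffNat α k : ℂ) * z ^ k = (((3 / 2 : ℝ) ^ α : ℝ) : ℂ) *
      ∑ m ∈ Finset.range (k + 1), gCoeff α m * (z / 3) ^ m * (gCoeff α (k - m) * z ^ (k - m)) := by
    rw [qCoeffNat, Complex.ofReal_mul, Complex.ofReal_sum, mul_assoc, Finset.sum_mul]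
    congr 1
    refine Finset.sum_congr rfl fun m hm => ?_
    have : z ^ k = z ^ m * z ^ (k - m) := by
      rw [← pow_add, Nat.add_sub_of_le (Finset.mem_range_succ_iff.1 hm)]
    rw [this, div_pow]
    push_cast
    rw [div_pow, one_pow]
    ring
  simp_rw [e]
  exact h.mul_left _

/-- Both bases have nonnegative real part on the closed disc and so avoid the branch cut; at `z =
1`, where `1 - z` vanishes, continuity comes from `α > 0`. -/
theorem continuousAt_powerSymbol {α : ℝ} (hα : 0 < α) {z : ℂ} (hz : ‖z‖ ≤ 1) :
    ContinuousAt (powerSymbol α) z := by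
  have hre := (Complex.re_le_norm z).trans hz
  have h1 : ContinuousAt (fun w : ℂ => w ^ (α : ℂ)) (1 - z) :=
    Complex.continuousAt_cpow_const_of_re_pos (.inl (by simpa using hre)) (by simpa using hα)
  have h2 : ContinuousAt (fun w : ℂ => w ^ (α : ℂ)) (1 - z / 3) := by
    refine Complex.continuousAt_cpow_const_of_re_pos (.inl ?_) (by simpa using hα)
    have : (z / 3).re = z.re / 3 := by simp
    rw [Complex.sub_re, this, Complex.one_re]
    linarith
  have h1' : ContinuousAt (fun w : ℂ => (1 - w) ^ (α : ℂ)) z :=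
    ContinuousAt.comp (f := fun w : ℂ => 1 - w) h1 (by fun_prop)
  have h2' : ContinuousAt (fun w : ℂ => (1 - w / 3) ^ (α : ℂ)) z :=
    ContinuousAt.comp (f := fun w : ℂ => 1 - w / 3) h2 (by fun_prop)
  exact continuousAt_const.mul (h2'.mul h1')

theorem integral_exp_int_mul_I (n : ℤ) :
    ∫ x in (0 : ℝ)..2 * Real.pi, Complex.exp ((n * x : ℝ) * Complex.I)
      = if n = 0 then 2 * (Real.pi : ℂ) else 0 := by
  split_ifs with h
  · simp [h]
  · have hn : (n : ℂ) * Complex.I ≠ 0 := mul_ne_zero (by exact_mod_cast h) Complex.I_ne_zero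
    have e : ∀ x : ℝ, Complex.exp ((n * x : ℝ) * Complex.I)
        = Complex.exp ((n : ℂ) * Complex.I * x) := fun x => by push_cast; ring_nf
    simp_rw [e]
    rw [integral_exp_mul_complex hn]
    have : (n : ℂ) * Complex.I * ((2 * Real.pi : ℝ) : ℂ) = n * (2 * Real.pi * Complex.I) := by
      push_cast; ring
    rw [this, Complex.exp_int_mul_two_pi_mul_I]
    simp

/-- Inside the disc the series may be integrated term by term. The radius tends to `1` only
afterwards, by continuity in `ρ`, so no summability on the circle is needed. For `n < 0` the
exponent `n.toNat` is harmless since the coefficient is zero. -/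
theorem integral_powerSymbol_of_lt_one (α : ℝ) {ρ : ℝ} (h0 : 0 ≤ ρ) (h1 : ρ < 1) (n : ℤ) :
    ∫ x in (0 : ℝ)..2 * Real.pi, powerSymbol α (ρ * Complex.exp (x * Complex.I))
        * Complex.exp (-(n * x : ℝ) * Complex.I)
      = 2 * Real.pi * (qCoeff α n * ρ ^ n.toNat : ℝ) := by
  have hz (x : ℝ) : ‖(ρ : ℂ) * Complex.exp (x * Complex.I)‖ = ρ := by
    rw [norm_mul, Complex.norm_exp_ofReal_mul_I, mul_one, Complex.norm_of_nonneg h0]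
  have hs : Summable fun k => ‖(qCoeffNat α k : ℂ) * (ρ : ℂ) ^ k‖ :=
    (hasSum_qCoeffNat α (z := ρ) (by rwa [Complex.norm_of_nonneg h0])).summable.norm
  have term (k : ℕ) (x : ℝ) : (qCoeffNat α k : ℂ) * (ρ * Complex.exp (x * Complex.I)) ^ k
      * Complex.exp (-(n * x : ℝ) * Complex.I)
      = qCoeffNat α k * ρ ^ k * Complex.exp ((((k - n : ℤ) : ℝ) * x : ℝ) * Complex.I) := by
    rw [mul_pow, ← Complex.exp_nat_mul, mul_assoc, mul_assoc, mul_assoc, ← Complex.exp_add]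
    push_cast
    ring_nf
  have key : HasSum (fun k : ℕ => ∫ x in (0 : ℝ)..2 * Real.pi,
      (qCoeffNat α k : ℂ) * ρ ^ k * Complex.exp ((((k - n : ℤ) : ℝ) * x : ℝ) * Complex.I))
      (∫ x in (0 : ℝ)..2 * Real.pi, powerSymbol α (ρ * Complex.exp (x * Complex.I))
        * Complex.exp (-(n * x : ℝ) * Complex.I)) := by
    refine intervalIntegral.hasSum_integral_of_dominated_convergence
      (fun k _ => ‖(qCoeffNat α k : ℂ) * (ρ : ℂ) ^ k‖) (fun k => ?_) (fun k => ?_) ?_ ?_ ?_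
    · exact Continuous.aestronglyMeasurable (by fun_prop)
    · refine .of_forall fun x _ => ?_
      rw [norm_mul, Complex.norm_exp_ofReal_mul_I, mul_one]
    · exact .of_forall fun x _ => hs
    · exact intervalIntegrable_const
    · refine .of_forall fun x _ => ?_
      simp_rw [← term]
      exact (hasSum_qCoeffNat α (by rw [hz]; exact h1)).mul_right _
  rw [← key.tsum_eq]
  simp_rw [intervalIntegral.integral_const_mul, integral_exp_int_mul_I]
  rcases lt_or_ge n 0 with hn | hn
  · rw [qCoeff, if_pos hn]
    simp only [sub_eq_zero, mul_ite, mul_zero]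
    rw [tsum_congr (fun k : ℕ => if_neg (by omega))]
    simp
  · rw [qCoeff, if_neg hn.not_gt, tsum_eq_single n.toNat (fun k hk => by
      rw [if_neg (by omega), mul_zero]), if_pos (by omega)]
    push_cast
    ring

theorem continuous_powerSymbol_polar {α : ℝ} (hα : 0 < α) :
    Continuous fun y : Set.Icc (0 : ℝ) 1 × ℝ =>
      powerSymbol α ((y.1 : ℝ) * Complex.exp (y.2 * Complex.I)) := by
  rw [continuous_iff_continuousAt]
  intro y
  refine ContinuousAt.comp (g := powerSymbol α) (continuousAt_powerSymbol hα ?_)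
    (Continuous.continuousAt (by fun_prop))
  rw [norm_mul, Complex.norm_exp_ofReal_mul_I, mul_one, Complex.norm_of_nonneg y.1.2.1]
  exact y.1.2.2

theorem continuous_powerSymbol_circle {α : ℝ} (hα : 0 < α) :
    Continuous fun x : ℝ => powerSymbol α (Complex.exp (x * Complex.I)) := by
  have := (continuous_powerSymbol_polar hα).comp
    (show Continuous fun x : ℝ => ((⟨1, by simp⟩ : Set.Icc (0 : ℝ) 1), x) by fun_prop)
  simpa [Function.comp_def] using this

/-- The coefficients `qCoeff α` are the Fourier coefficients of their generating function. -/
theorem integral_powerSymbol {α : ℝ} (hα : 0 < α) (n : ℤ) :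
    ∫ x in (0 : ℝ)..2 * Real.pi, powerSymbol α (Complex.exp (x * Complex.I))
        * Complex.exp (-(n * x : ℝ) * Complex.I) = 2 * Real.pi * (qCoeff α n : ℝ) := by
  have hL : Continuous fun ρ : Set.Icc (0 : ℝ) 1 => ∫ x in (0 : ℝ)..2 * Real.pi,
      powerSymbol α ((ρ : ℝ) * Complex.exp (x * Complex.I))
        * Complex.exp (-(n * x : ℝ) * Complex.I) := by
    refine intervalIntegral.continuous_parametric_intervalIntegral_of_continuous' ?_ _ _
    exact (continuous_powerSymbol_polar hα).mul (by fun_prop)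
  have hR : Continuous fun ρ : Set.Icc (0 : ℝ) 1 =>
      2 * (Real.pi : ℂ) * (qCoeff α n * (ρ : ℝ) ^ n.toNat : ℝ) := by fun_prop
  have hd : Dense {ρ : Set.Icc (0 : ℝ) 1 | (ρ : ℝ) < 1} := by
    have : {ρ : Set.Icc (0 : ℝ) 1 | (ρ : ℝ) < 1} = {⟨1, by simp⟩}ᶜ := by
      ext ρ
      simp only [Set.mem_ofPred_eq, Set.mem_compl_iff, Set.mem_singleton_iff, Subtype.ext_iff]
      exact ⟨fun h => h.ne, fun h => lt_of_le_of_ne ρ.2.2 h⟩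
    rw [this]
    exact dense_compl_singleton _
  have := Continuous.ext_on hd hL hR fun ρ hρ => integral_powerSymbol_of_lt_one α ρ.2.1 hρ n
  simpa using congrFun this ⟨1, by simp⟩

theorem qCoeff_eq_integral {α : ℝ} (hα : 0 < α) (n : ℤ) :
    qCoeff α n = (2 * Real.pi)⁻¹ * ∫ x in (0 : ℝ)..2 * Real.pi,
      shiftedRe (powerSymbol α (Complex.exp (x * Complex.I))) x n := by
  have hc : Continuous fun x : ℝ => powerSymbol α (Complex.exp (x * Complex.I))
      * Complex.exp (-(n * x : ℝ) * Complex.I) :=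
    (continuous_powerSymbol_circle hα).mul (by fun_prop)
  have h := congrArg Complex.re (integral_powerSymbol hα n)
  have e := Complex.reCLM.intervalIntegral_comp_comm
    (hc.intervalIntegrable (μ := MeasureTheory.volume) 0 (2 * Real.pi))
  simp only [Complex.reCLM_apply] at e
  rw [← e] at h
  have hr : (2 * (Real.pi : ℂ) * (qCoeff α n : ℝ)).re = 2 * Real.pi * qCoeff α n := by
    rw [← Complex.ofReal_ofNat, ← Complex.ofReal_mul, ← Complex.ofReal_mul, Complex.ofReal_re]
  rw [hr] at h
  simp only [shiftedRe]
  rw [h, ← mul_assoc, inv_mul_cancel₀ (by positivity), one_mul]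

/-! ### Writing `w^α` as a positive combination of `w` and `w²`. -/

theorem sin_mul_div_sin_pos {t θ : ℝ} (ht : 0 < t) (ht' : t < 1) (hθ : |θ| < Real.pi)
    (hθ' : θ ≠ 0) : 0 < Real.sin (t * θ) / Real.sin θ := by
  wlog h : 0 < θ generalizing θ
  · have := this (θ := -θ) (by rwa [abs_neg]) (neg_ne_zero.2 hθ')
      (by linarith [lt_of_le_of_ne (not_lt.1 h) hθ'])
    rwa [mul_neg, Real.sin_neg, Real.sin_neg, neg_div_neg_eq] at this
  rw [abs_of_pos h] at hθ
  exact div_pos (Real.sin_pos_of_pos_of_lt_pi (mul_pos ht h) (by nlinarith))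
    (Real.sin_pos_of_pos_of_lt_pi h hθ)

theorem sin_mul_div_sin_le {t θ : ℝ} (ht : 0 ≤ t) (ht' : t ≤ 1 / 2) (hθ : |θ| < Real.pi)
    (hθ' : θ ≠ 0) : Real.sin (t * θ) / Real.sin θ ≤ Real.sin ((1 - t) * θ) / Real.sin θ := by
  wlog h : 0 < θ generalizing θ
  · have := this (θ := -θ) (by rwa [abs_neg]) (neg_ne_zero.2 hθ')
      (by linarith [lt_of_le_of_ne (not_lt.1 h) hθ'])
    rwa [mul_neg, mul_neg, Real.sin_neg, Real.sin_neg, Real.sin_neg, neg_div_neg_eq,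
      neg_div_neg_eq] at this
  rw [abs_of_pos h] at hθ
  refine div_le_div_of_nonneg_right ?_ (Real.sin_pos_of_pos_of_lt_pi h hθ).le
  -- The difference is `2 sin ((1 - 2t) θ / 2) cos (θ / 2)`, with both angles in `[0, π/2]`.
  rw [← sub_nonneg, Real.sin_sub_sin]
  refine mul_nonneg (mul_nonneg zero_le_two (Real.sin_nonneg_of_nonneg_of_le_pi ?_ ?_))
    (Real.cos_nonneg_of_neg_pi_div_two_le_of_le ?_ ?_) <;> nlinarith

/-- With `θ = L.im`, the direction `αθ` is resolved along `θ` and `2θ`: `sin θ e^{iαθ} = sin ((2 -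
α)θ) e^{iθ} + sin ((α - 1)θ) e^{2iθ}`. The real exponentials correct the moduli. -/
theorem exp_mul_eq_of_between {α : ℝ} {L : ℂ} (hs : Real.sin L.im ≠ 0) :
    Complex.exp (α * L) =
      (Real.exp ((α - 1) * L.re) * (Real.sin ((2 - α) * L.im) / Real.sin L.im) : ℝ)
          * Complex.exp L
        + (Real.exp ((α - 2) * L.re) * (Real.sin ((α - 1) * L.im) / Real.sin L.im) : ℝ)
          * Complex.exp L ^ 2 := by
  obtain ⟨r, θ⟩ := L
  simp only at *
  have e1 : Real.exp (α * r) = Real.exp ((α - 1) * r) * Real.exp r := by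
    rw [← Real.exp_add]; ring_nf
  have e2 : Real.exp (α * r) = Real.exp ((α - 2) * r) * Real.exp (2 * r) := by
    rw [← Real.exp_add]; ring_nf
  have h1 : (2 - α) * θ = θ - (α - 1) * θ := by ring
  have h2 : α * θ = (α - 1) * θ + θ := by ring
  have t1 : Real.cos (α * θ) = Real.sin ((2 - α) * θ) / Real.sin θ * Real.cos θ
      + Real.sin ((α - 1) * θ) / Real.sin θ * Real.cos (2 * θ) := by
    rw [div_mul_eq_mul_div, div_mul_eq_mul_div, ← add_div, eq_div_iff hs, h1, h2, Real.sin_sub,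
      Real.cos_add, Real.cos_two_mul]
    linear_combination -Real.sin ((α - 1) * θ) * Real.sin_sq_add_cos_sq θ
  have t2 : Real.sin (α * θ) = Real.sin ((2 - α) * θ) / Real.sin θ * Real.sin θ
      + Real.sin ((α - 1) * θ) / Real.sin θ * Real.sin (2 * θ) := by
    rw [div_mul_eq_mul_div, div_mul_eq_mul_div, ← add_div, eq_div_iff hs, h1, h2, Real.sin_sub,
      Real.sin_add, Real.sin_two_mul]
    ring
  have l1 : (α : ℂ) * ⟨r, θ⟩ = ⟨α * r, α * θ⟩ := by apply Complex.ext <;> simp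
  have l2 : ((2 : ℕ) : ℂ) * ⟨r, θ⟩ = ⟨2 * r, 2 * θ⟩ := by apply Complex.ext <;> simp
  rw [← Complex.exp_nat_mul, l1, l2]
  apply Complex.ext
  · simp only [Complex.add_re, Complex.re_ofReal_mul, Complex.exp_re]
    linear_combination Real.exp (α * r) * t1
      + Real.sin ((2 - α) * θ) / Real.sin θ * Real.cos θ * e1
      + Real.sin ((α - 1) * θ) / Real.sin θ * Real.cos (2 * θ) * e2
  · simp only [Complex.add_im, Complex.im_ofReal_mul, Complex.exp_im]
    linear_combination Real.exp (α * r) * t2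
      + Real.sin ((2 - α) * θ) / Real.sin θ * Real.sin θ * e1
      + Real.sin ((α - 1) * θ) / Real.sin θ * Real.sin (2 * θ) * e2

theorem exists_powerSymbol_eq {α x : ℝ} (h1 : 1 < α) (h2 : α < 2) (hx : Real.sin x ≠ 0) :
    ∃ c d : ℝ, 0 < c ∧ 0 < d ∧ powerSymbol α (Complex.exp (x * Complex.I))
        = c * baseSymbol x + d * baseSymbol x ^ 2 ∧
      (α ≤ 3 / 2 → d * (2 * (1 - Real.cos x)) < c) := by
  have hcos : -1 < Real.cos x ∧ Real.cos x < 1 := by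
    have h : Real.cos x ^ 2 < 1 := by
      nlinarith [Real.sin_sq_add_cos_sq x, sq_pos_of_ne_zero hx]
    exact abs_lt.1 ((sq_lt_one_iff_abs_lt_one _).1 h)
  set z := Complex.exp (x * Complex.I) with hz
  have hzre : z.re = Real.cos x := Complex.exp_ofReal_mul_I_re x
  have hb : 0 < (1 - z).re := by rw [Complex.sub_re, hzre, Complex.one_re]; linarith
  have ha : 0 < (1 - z / 3).re := by
    have : (z / 3).re = z.re / 3 := by simp
    rw [Complex.sub_re, this, hzre, Complex.one_re]; linarith
  have hb0 : 1 - z ≠ 0 := fun h => by simp [h] at hb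
  have ha0 : 1 - z / 3 ≠ 0 := fun h => by simp [h] at ha
  -- The logarithm is taken factor by factor, from `w = 3/2 (1 - z/3) (1 - z)`. Each factor lies in
  -- the right half-plane, hence `|L.im| < π`.
  set L : ℂ := (Real.log (3 / 2) : ℂ) + Complex.log (1 - z / 3) + Complex.log (1 - z) with hL
  have hexp : Complex.exp L = baseSymbol x := by
    rw [hL, Complex.exp_add, Complex.exp_add, Complex.exp_log ha0, Complex.exp_log hb0,
      ← Complex.ofReal_exp, Real.exp_log (by norm_num), baseSymbol]
    push_cast
    ring
  have hpow : powerSymbol α z = Complex.exp (α * L) := by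
    rw [powerSymbol, Complex.cpow_def_of_ne_zero ha0, Complex.cpow_def_of_ne_zero hb0,
      Real.rpow_def_of_pos (by norm_num), Complex.ofReal_exp, ← Complex.exp_add,
      ← Complex.exp_add, hL]
    push_cast
    ring_nf
  have him : |L.im| < Real.pi := by
    have e : L.im = (1 - z / 3).arg + (1 - z).arg := by simp [hL, Complex.log_im]
    rw [e]
    have p1 := abs_lt.1 (Complex.abs_arg_lt_pi_div_two_iff.2 (.inl ha))
    have p2 := abs_lt.1 (Complex.abs_arg_lt_pi_div_two_iff.2 (.inl hb))
    rw [abs_lt]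
    constructor <;> linarith [p1.1, p1.2, p2.1, p2.2]
  have hsin : Real.sin L.im ≠ 0 := by
    intro h
    have := congrArg Complex.im hexp
    rw [Complex.exp_im, h, mul_zero, baseSymbol_im, eq_comm, neg_eq_zero, mul_eq_zero] at this
    exact this.elim hx fun h => by linarith [hcos.2]
  have him0 : L.im ≠ 0 := fun h => hsin (by rw [h, Real.sin_zero])
  have hd := sin_mul_div_sin_pos (t := α - 1) (by linarith) (by linarith) him him0
  refine ⟨_, _, mul_pos (Real.exp_pos _)
      (sin_mul_div_sin_pos (t := 2 - α) (by linarith) (by linarith) him him0),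
    mul_pos (Real.exp_pos _) hd, by rw [hpow, exp_mul_eq_of_between hsin, hexp], fun h => ?_⟩
  have hle := sin_mul_div_sin_le (t := α - 1) (by linarith) (by linarith) him him0
  rw [show 1 - (α - 1) = 2 - α by ring] at hle
  have hr : Real.exp L.re = ‖baseSymbol x‖ := by rw [← hexp, Complex.norm_exp]
  -- After squaring, with `u = cos x`, this is `4 (1 - u)² < (1 - u) (5 - 3u)`, that is `u > -1`.
  have hE : 2 * (1 - Real.cos x) < Real.exp L.re := by
    rw [hr]
    refine lt_of_pow_lt_pow_left₀ 2 (norm_nonneg _) ?_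
    rw [norm_baseSymbol_sq]
    nlinarith
  have e : Real.exp ((α - 1) * L.re) = Real.exp ((α - 2) * L.re) * Real.exp L.re := by
    rw [← Real.exp_add]; ring_nf
  rw [e]
  have hp := Real.exp_pos ((α - 2) * L.re)
  calc _ < Real.exp ((α - 2) * L.re) * (Real.sin ((α - 1) * L.im) / Real.sin L.im)
        * Real.exp L.re := mul_lt_mul_of_pos_left hE (mul_pos hp hd)
    _ ≤ _ := by
      rw [mul_right_comm]
      exact mul_le_mul_of_nonneg_left hle (mul_pos hp (Real.exp_pos _)).le

namespace WSLDShifts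

theorem sum_powerSymbol_neg {S : WSLDShifts} {α x : ℝ} (hS : S.Effective)
    (hadm : S.Admissible α) (h1 : 1 < α) (h2 : α < 2) (hx : Real.sin x ≠ 0) :
    S.sum α (shiftedRe (powerSymbol α (Complex.exp (x * Complex.I))) x) < 0 := by
  have hcos : -1 < Real.cos x ∧ Real.cos x < 1 := by
    have h : Real.cos x ^ 2 < 1 := by
      nlinarith [Real.sin_sq_add_cos_sq x, sq_pos_of_ne_zero hx]
    exact abs_lt.1 ((sq_lt_one_iff_abs_lt_one _).1 h)
  obtain ⟨c, d, hc, hd, e, hcd⟩ := exists_powerSymbol_eq h1 h2 hx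
  obtain ⟨hX, hZ⟩ := sum_baseSymbol_neg hS hadm h1 h2 hcos.1 hcos.2
  have e' : shiftedRe (powerSymbol α (Complex.exp (x * Complex.I))) x = fun p =>
      c * shiftedRe (baseSymbol x) x p + d * shiftedRe (baseSymbol x ^ 2) x p := by
    funext p
    simp only [shiftedRe]
    rw [e, add_mul, mul_assoc, mul_assoc, Complex.add_re, Complex.re_ofReal_mul,
      Complex.re_ofReal_mul]
  have hlin : S.sum α (shiftedRe (powerSymbol α (Complex.exp (x * Complex.I))) x)
      = c * S.sum α (shiftedRe (baseSymbol x) x)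
          + d * S.sum α (shiftedRe (baseSymbol x ^ 2) x) := by
    rw [e']
    simp only [sum, wsldSum₃, wsldSum₂]
    ring
  rw [hlin]
  rcases hZ with hZ | ⟨hα, hZ⟩
  · linarith [mul_neg_of_pos_of_neg hc hX, mul_nonpos_of_nonneg_of_nonpos hd.le hZ]
  -- With `X`, `Z` the sums for `w`, `w²`: `c X + d Z ≤ (c - 2 (1 - cos x) d) X < 0`.
  · have a1 := mul_nonpos_of_nonneg_of_nonpos hd.le hZ
    have a2 := mul_lt_mul_of_neg_right (hcd hα) hX
    linarith

theorem exists_sum_eq (S : WSLDShifts) (α : ℝ) :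
    ∃ (c : Fin 8 → ℝ) (k : Fin 8 → ℤ), ∀ f, S.sum α f = ∑ i, c i * f (k i) := by
  refine ⟨![S.weight₄ α * (weight₃ α S.p S.q S.r S.s * weight₂ S.p S.q),
    S.weight₄ α * (weight₃ α S.p S.q S.r S.s * weight₂ S.q S.p),
    S.weight₄ α * (weight₃ α S.r S.s S.p S.q * weight₂ S.r S.s),
    S.weight₄ α * (weight₃ α S.r S.s S.p S.q * weight₂ S.s S.r),
    S.weight₄' α * (weight₃ α S.p' S.q' S.r' S.s' * weight₂ S.p' S.q'),
    S.weight₄' α * (weight₃ α S.p' S.q' S.r' S.s' * weight₂ S.q' S.p'),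
    S.weight₄' α * (weight₃ α S.r' S.s' S.p' S.q' * weight₂ S.r' S.s'),
    S.weight₄' α * (weight₃ α S.r' S.s' S.p' S.q' * weight₂ S.s' S.r')],
    ![S.p, S.q, S.r, S.s, S.p', S.q', S.r', S.s'], fun f => ?_⟩
  simp only [Fin.sum_univ_eight, sum, wsldSum₃, wsldSum₂, Matrix.cons_val]
  ring

theorem matrix_apply (S : WSLDShifts) (α : ℝ) (n : ℕ) (i j : Fin n) :
    S.matrix α n i j = S.sum α fun p => qCoeff α (p + (i : ℤ) - (j : ℤ)) := by
  simp only [matrix, wsldMatrix₃, wsldMatrix₂, lubichMatrix, Matrix.add_apply, Matrix.smul_apply,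
    Matrix.of_apply, smul_eq_mul, sum, wsldSum₃, wsldSum₂]

end WSLDShifts

/-! ### The quadratic form of `A_α` as an integral of its symbol. -/

/-- The trigonometric polynomial with the entries of `v` as coefficients. -/
noncomputable def trigSum {n : ℕ} (v : Fin n → ℝ) (x : ℝ) : ℂ :=
  ∑ i, (v i : ℂ) * Complex.exp (-(i * x : ℝ) * Complex.I)

theorem continuous_trigSum {n : ℕ} (v : Fin n → ℝ) : Continuous (trigSum v) := by
  unfold trigSum; fun_prop

/-- Otherwise a polynomial with coefficients `v` would have infinitely many roots on the circle. The
interval `(0, π)` is one where the symbol is strictly negative. -/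
theorem exists_trigSum_ne_zero {n : ℕ} {v : Fin n → ℝ} (hv : v ≠ 0) :
    ∃ x ∈ Set.Ioo 0 Real.pi, trigSum v x ≠ 0 := by
  by_contra! h
  apply hv
  let P : Polynomial ℂ := ∑ i : Fin n, Polynomial.C (v i : ℂ) * Polynomial.X ^ (i : ℕ)
  have hP (x : ℝ) : P.eval (Complex.exp (-x * Complex.I)) = trigSum v x := by
    simp only [P, Polynomial.eval_finsetSum, Polynomial.eval_mul, Polynomial.eval_C,
      Polynomial.eval_pow, Polynomial.eval_X, trigSum, ← Complex.exp_nat_mul]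
    refine Finset.sum_congr rfl fun i _ => ?_
    push_cast
    ring_nf
  have hinj : Set.InjOn (fun x : ℝ => Complex.exp (-x * Complex.I)) (Set.Ioo 0 Real.pi) := by
    intro a ha b hb hab
    have := congrArg Complex.re hab
    simp only [← Complex.ofReal_neg, Complex.exp_ofReal_mul_I_re, Real.cos_neg] at this
    exact Real.injOn_cos (Set.Ioo_subset_Icc_self ha) (Set.Ioo_subset_Icc_self hb) this
  have hP0 : P = 0 := by
    refine Polynomial.eq_zero_of_infinite_isRoot P
      (((Set.Ioo_infinite Real.pi_pos).image hinj).mono ?_)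
    rintro _ ⟨x, hx, rfl⟩
    exact (hP x).trans (h x hx)
  funext j
  have := congrArg (fun p => p.coeff (j : ℕ)) hP0
  simp only [P, Polynomial.finsetSum_coeff, Polynomial.coeff_C_mul_X_pow, Fin.val_inj,
    Finset.sum_ite_eq, Finset.mem_univ, if_true, Polynomial.coeff_zero] at this
  exact_mod_cast this

theorem sum_mul_shiftedRe {n : ℕ} (v : Fin n → ℝ) (w : ℂ) (x : ℝ) (p : ℤ) :
    ∑ i, ∑ j, v i * v j * shiftedRe w x (p + (i : ℤ) - (j : ℤ))
      = Complex.normSq (trigSum v x) * shiftedRe w x p := by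
  have hc : (starRingEnd ℂ) (trigSum v x)
      = ∑ j, (v j : ℂ) * Complex.exp ((j * x : ℝ) * Complex.I) := by
    simp only [trigSum, map_sum, map_mul, Complex.conj_ofReal, ← Complex.exp_conj, map_neg,
      Complex.conj_I]
    simp
  have e : (Complex.normSq (trigSum v x) : ℂ) * (w * Complex.exp (-(p * x : ℝ) * Complex.I))
      = ∑ i, ∑ j, ((v i * v j : ℝ) : ℂ) *
        (w * Complex.exp (-(((p + (i : ℤ) - (j : ℤ) : ℤ) : ℝ) * x : ℝ) * Complex.I)) := by
    rw [← Complex.mul_conj, hc, trigSum, Finset.sum_mul_sum, Finset.sum_mul]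
    refine Finset.sum_congr rfl fun i _ => ?_
    rw [Finset.sum_mul]
    refine Finset.sum_congr rfl fun j _ => ?_
    have : Complex.exp (-(((p + (i : ℤ) - (j : ℤ) : ℤ) : ℝ) * x : ℝ) * Complex.I)
        = Complex.exp (-(i * x : ℝ) * Complex.I) * Complex.exp ((j * x : ℝ) * Complex.I)
          * Complex.exp (-(p * x : ℝ) * Complex.I) := by
      rw [← Complex.exp_add, ← Complex.exp_add]; push_cast; ring_nf
    rw [this]
    push_cast
    ring
  have := congrArg Complex.re e
  rw [Complex.re_ofReal_mul] at this
  simp only [shiftedRe]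
  rw [this]
  simp only [Complex.re_sum, Complex.re_ofReal_mul]

theorem continuous_shiftedRe_powerSymbol {α : ℝ} (hα : 0 < α) (p : ℤ) :
    Continuous fun x : ℝ => shiftedRe (powerSymbol α (Complex.exp (x * Complex.I))) x p :=
  Complex.continuous_re.comp ((continuous_powerSymbol_circle hα).mul (by fun_prop))

namespace WSLDShifts

theorem continuous_sum_powerSymbol (S : WSLDShifts) {α : ℝ} (hα : 0 < α) :
    Continuous fun x : ℝ =>
      S.sum α (shiftedRe (powerSymbol α (Complex.exp (x * Complex.I))) x) := by
  obtain ⟨c, k, hc⟩ := S.exists_sum_eq α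
  simp only [hc]
  exact continuous_finsetSum _ fun i _ =>
    continuous_const.mul (continuous_shiftedRe_powerSymbol hα _)

theorem quadratic_form_eq_integral (S : WSLDShifts) {α : ℝ} (hα : 0 < α) {n : ℕ}
    (v : Fin n → ℝ) : v ⬝ᵥ (S.matrix α n).mulVec v = (2 * Real.pi)⁻¹ *
      ∫ x in (0 : ℝ)..2 * Real.pi, Complex.normSq (trigSum v x) *
        S.sum α (shiftedRe (powerSymbol α (Complex.exp (x * Complex.I))) x) := by
  obtain ⟨c, k, hc⟩ := S.exists_sum_eq α
  have hp (p : ℤ) : ∑ i, ∑ j, v i * v j * qCoeff α (p + (i : ℤ) - (j : ℤ))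
      = (2 * Real.pi)⁻¹ * ∫ x in (0 : ℝ)..2 * Real.pi, Complex.normSq (trigSum v x) *
        shiftedRe (powerSymbol α (Complex.exp (x * Complex.I))) x p := by
    simp_rw [← sum_mul_shiftedRe]
    have hi (i j : Fin n) : IntervalIntegrable (fun x : ℝ => v i * v j *
        shiftedRe (powerSymbol α (Complex.exp (x * Complex.I))) x (p + (i : ℤ) - (j : ℤ)))
        MeasureTheory.volume 0 (2 * Real.pi) :=
      (continuous_const.mul (continuous_shiftedRe_powerSymbol hα _)).intervalIntegrable _ _
    have hi' (i : Fin n) : IntervalIntegrable (fun x : ℝ => ∑ j : Fin n, v i * v j *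
        shiftedRe (powerSymbol α (Complex.exp (x * Complex.I))) x (p + (i : ℤ) - (j : ℤ)))
        MeasureTheory.volume 0 (2 * Real.pi) :=
      (continuous_finsetSum _ fun j _ => continuous_const.mul
        (continuous_shiftedRe_powerSymbol hα _)).intervalIntegrable _ _
    rw [intervalIntegral.integral_finsetSum fun i _ => hi' i, Finset.mul_sum]
    refine Finset.sum_congr rfl fun i _ => ?_
    rw [intervalIntegral.integral_finsetSum fun j _ => hi i j, Finset.mul_sum]
    refine Finset.sum_congr rfl fun j _ => ?_
    rw [intervalIntegral.integral_const_mul, qCoeff_eq_integral hα]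
    ring
  have hL : v ⬝ᵥ (S.matrix α n).mulVec v
      = ∑ l, c l * ∑ i, ∑ j, v i * v j * qCoeff α (k l + (i : ℤ) - (j : ℤ)) := by
    simp only [dotProduct, Matrix.mulVec, matrix_apply, hc, Finset.mul_sum, Finset.sum_mul]
    rw [Finset.sum_comm]
    simp_rw [Finset.sum_comm (s := (Finset.univ : Finset (Fin 8)))]
    rw [Finset.sum_comm]
    exact Finset.sum_congr rfl fun i _ => Finset.sum_congr rfl fun j _ =>
      Finset.sum_congr rfl fun l _ => by ring
  rw [hL]
  simp_rw [hp, hc, Finset.mul_sum]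
  have hi (l : Fin 8) : IntervalIntegrable (fun x : ℝ => Complex.normSq (trigSum v x) *
      (c l * shiftedRe (powerSymbol α (Complex.exp (x * Complex.I))) x (k l)))
      MeasureTheory.volume 0 (2 * Real.pi) :=
    ((Complex.continuous_normSq.comp (continuous_trigSum v)).mul (continuous_const.mul
      (continuous_shiftedRe_powerSymbol hα _))).intervalIntegrable _ _
  rw [intervalIntegral.integral_finsetSum fun l _ => hi l, Finset.mul_sum]
  refine Finset.sum_congr rfl fun l _ => ?_
  simp_rw [mul_left_comm _ (c l), intervalIntegral.integral_const_mul]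
  ring

/-- The matrices of the effective fourth order operators are negative definite. -/
theorem quadratic_form_neg {S : WSLDShifts} {α : ℝ} (hS : S.Effective) (hadm : S.Admissible α)
    (h1 : 1 < α) (h2 : α < 2) {n : ℕ} {v : Fin n → ℝ} (hv : v ≠ 0) :
    v ⬝ᵥ (S.matrix α n).mulVec v < 0 := by
  have hα : 0 < α := by linarith
  have hc := S.continuous_sum_powerSymbol hα
  have hclosed := isClosed_le hc continuous_const (g := fun _ => (0 : ℝ))
  -- Strict negativity is known where `sin x ≠ 0`; the remaining points are reached by closure.
  have hle : ∀ x ∈ Set.Ioc 0 (2 * Real.pi),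
      S.sum α (shiftedRe (powerSymbol α (Complex.exp (x * Complex.I))) x) ≤ 0 := by
    have hpi := Real.pi_pos
    intro x hx
    have a1 : Set.Icc 0 Real.pi ⊆ {b : ℝ | S.sum α (shiftedRe
        (powerSymbol α (Complex.exp (b * Complex.I))) b) ≤ 0} := by
      rw [← closure_Ioo hpi.ne]
      exact closure_minimal (fun y hy => (sum_powerSymbol_neg hS hadm h1 h2
        (Real.sin_pos_of_pos_of_lt_pi hy.1 hy.2).ne').le) hclosed
    have a2 : Set.Icc Real.pi (2 * Real.pi) ⊆ {b : ℝ | S.sum α (shiftedRe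
        (powerSymbol α (Complex.exp (b * Complex.I))) b) ≤ 0} := by
      rw [← closure_Ioo (by linarith)]
      refine closure_minimal (fun y hy => (sum_powerSymbol_neg hS hadm h1 h2 ?_).le) hclosed
      rw [← neg_ne_zero, ← Real.sin_sub_pi]
      exact (Real.sin_pos_of_pos_of_lt_pi (by linarith [hy.1]) (by linarith [hy.2])).ne'
    rcases le_total x Real.pi with h | h
    · exact a1 ⟨hx.1.le, h⟩
    · exact a2 ⟨h, hx.2⟩
  rw [quadratic_form_eq_integral S hα]
  refine mul_neg_of_pos_of_neg (by positivity) ?_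
  rw [← neg_pos, ← intervalIntegral.integral_neg]
  obtain ⟨c, hc', hcv⟩ := exists_trigSum_ne_zero hv
  refine intervalIntegral.integral_pos (by positivity)
    (((Complex.continuous_normSq.comp (continuous_trigSum v)).mul hc).neg.continuousOn)
    (fun x hx => neg_nonneg.2 (mul_nonpos_of_nonneg_of_nonpos (Complex.normSq_nonneg _) (hle x hx)))
    ⟨c, ⟨hc'.1.le, by linarith [hc'.2, Real.pi_pos]⟩, neg_pos.2 (mul_neg_of_pos_of_neg
      (Complex.normSq_pos.2 hcv) (sum_powerSymbol_neg hS hadm h1 h2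
        (Real.sin_pos_of_pos_of_lt_pi hc'.1 hc'.2).ne'))⟩

end WSLDShifts

/-! ### Energy arguments for `diagonal d * B` with `B` negative definite. -/

section DiagonalMul

variable {n : ℕ} {d : Fin n → ℝ} {B : Matrix (Fin n) (Fin n) ℝ}

theorem diagonal_mul_mulVec_apply (d : Fin n → ℝ) (B : Matrix (Fin n) (Fin n) ℝ) (v : Fin n → ℝ)
    (i : Fin n) : (Matrix.diagonal d * B).mulVec v i = d i * B.mulVec v i := by
  rw [← Matrix.mulVec_mulVec, Matrix.mulVec_diagonal]

theorem sum_mul_diagonal_mul_mulVec_div (hd : ∀ i, 0 < d i) (u v : Fin n → ℝ) :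
    ∑ i, u i * (Matrix.diagonal d * B).mulVec v i / d i = u ⬝ᵥ B.mulVec v := by
  refine Finset.sum_congr rfl fun i _ => ?_
  rw [diagonal_mul_mulVec_apply]
  field_simp [(hd i).ne']

theorem sum_sq_div_pos (hd : ∀ i, 0 < d i) {v : Fin n → ℝ} (hv : v ≠ 0) :
    0 < ∑ i, v i ^ 2 / d i := by
  obtain ⟨i, hi⟩ := Function.ne_iff.1 hv
  have hi : v i ≠ 0 := hi
  exact Finset.sum_pos' (fun j _ => div_nonneg (sq_nonneg _) (hd j).le)
    ⟨i, Finset.mem_univ i, div_pos (by positivity) (hd i)⟩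

theorem isUnit_one_sub_diagonal_mul (hd : ∀ i, 0 < d i)
    (hB : ∀ v : Fin n → ℝ, v ≠ 0 → v ⬝ᵥ B.mulVec v < 0) :
    IsUnit (1 - Matrix.diagonal d * B) := by
  rw [← Matrix.mulVec_injective_iff_isUnit]
  refine (injective_iff_map_eq_zero (Matrix.mulVecLin _)).2 fun v hv => ?_
  by_contra hne
  have h1 : (Matrix.diagonal d * B).mulVec v = v := by
    rw [Matrix.mulVecLin_apply, Matrix.sub_mulVec, Matrix.one_mulVec, sub_eq_zero] at hv
    exact hv.symm
  have h2 := sum_mul_diagonal_mul_mulVec_div (B := B) hd v v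
  have h3 := sum_sq_div_pos hd hne
  simp only [h1, ← sq] at h2
  linarith [hB v hne]

/-- Pairing real and imaginary part `x`, `y` of the eigenvector with their images in the weighted
product, the terms with `z.im` cancel. -/
theorem re_neg_of_eigenvector (hd : ∀ i, 0 < d i)
    (hB : ∀ v : Fin n → ℝ, v ≠ 0 → v ⬝ᵥ B.mulVec v < 0) {z : ℂ} {w : Fin n → ℂ} (hw : w ≠ 0)
    (h : ((Matrix.diagonal d * B).map ((↑) : ℝ → ℂ)).mulVec w = z • w) : z.re < 0 := by
  set A := Matrix.diagonal d * B with hA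
  have hB' (v : Fin n → ℝ) : v ⬝ᵥ B.mulVec v ≤ 0 := by
    rcases eq_or_ne v 0 with rfl | hv
    · simp
    · exact (hB v hv).le
  let x : Fin n → ℝ := fun i => (w i).re
  let y : Fin n → ℝ := fun i => (w i).im
  have hx (i : Fin n) : A.mulVec x i = z.re * x i - z.im * y i := by
    simpa [Matrix.mulVec, dotProduct, Complex.re_sum] using congrArg Complex.re (congrFun h i)
  have hy (i : Fin n) : A.mulVec y i = z.re * y i + z.im * x i := by
    simpa [Matrix.mulVec, dotProduct, Complex.im_sum] using congrArg Complex.im (congrFun h i)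
  have key : z.re * (∑ i, x i ^ 2 / d i + ∑ i, y i ^ 2 / d i)
      = x ⬝ᵥ B.mulVec x + y ⬝ᵥ B.mulVec y := by
    rw [← sum_mul_diagonal_mul_mulVec_div hd x x, ← sum_mul_diagonal_mul_mulVec_div hd y y,
      ← Finset.sum_add_distrib, ← Finset.sum_add_distrib, Finset.mul_sum]
    refine Finset.sum_congr rfl fun i _ => ?_
    rw [← hA, hx, hy]
    ring
  have hnn (v : Fin n → ℝ) : 0 ≤ ∑ i, v i ^ 2 / d i :=
    Finset.sum_nonneg fun j _ => div_nonneg (sq_nonneg _) (hd j).le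
  by_contra! hz
  have hxy : x ≠ 0 ∨ y ≠ 0 := by
    by_contra! h0
    exact hw (funext fun i => Complex.ext (congrFun h0.1 i) (congrFun h0.2 i))
  have hnonneg := mul_nonneg hz (add_nonneg (hnn x) (hnn y))
  rcases hxy with h0 | h0
  · linarith [hB x h0, hB' y]
  · linarith [hB y h0, hB' x]

theorem Matrix.exists_mulVec_eq_smul_of_mem_spectrum {M : Matrix (Fin n) (Fin n) ℂ} {z : ℂ}
    (hz : z ∈ spectrum ℂ M) : ∃ w : Fin n → ℂ, w ≠ 0 ∧ M.mulVec w = z • w := by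
  rw [← Matrix.spectrum_toLin', ← Module.End.hasEigenvalue_iff_mem_spectrum] at hz
  obtain ⟨w, hw⟩ := hz.exists_hasEigenvector
  exact ⟨w, hw.2, by simpa using hw.apply_eq_smul⟩

theorem Matrix.finite_spectrum_complex (M : Matrix (Fin n) (Fin n) ℂ) :
    (spectrum ℂ M).Finite := by
  rw [← Matrix.spectrum_toLin']
  exact Module.End.finite_spectrum _

theorem Matrix.spectralRadius_lt_one {M : Matrix (Fin n) (Fin n) ℂ}
    (h : ∀ z ∈ spectrum ℂ M, ‖z‖ < 1) : spectralRadius ℂ M < 1 := by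
  have hf := M.finite_spectrum_complex
  have : spectralRadius ℂ M = hf.toFinset.sup fun z => (‖z‖₊ : ENNReal) := by
    simp [spectralRadius, Finset.sup_eq_iSup]
  -- The spectrum is empty when `n = 0`; the supremum is then `0`.
  rw [this, Finset.sup_lt_iff (by simp)]
  intro z hz
  have := h z (hf.mem_toFinset.1 hz)
  exact_mod_cast this

/-- Cayley transform: an eigenvector for `μ` is one of `A` for `(μ - 1) / (μ + 1)`, whose real part
has the sign of `‖μ‖² - 1`. -/
theorem norm_lt_one_of_mem_spectrum_amplification (hd : ∀ i, 0 < d i)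
    (hB : ∀ v : Fin n → ℝ, v ≠ 0 → v ⬝ᵥ B.mulVec v < 0) {μ : ℂ}
    (hμ : μ ∈ spectrum ℂ (((1 - Matrix.diagonal d * B)⁻¹ * (1 + Matrix.diagonal d * B)).map
      ((↑) : ℝ → ℂ))) : ‖μ‖ < 1 := by
  obtain ⟨w, hw, h⟩ := Matrix.exists_mulVec_eq_smul_of_mem_spectrum hμ
  have hU := isUnit_one_sub_diagonal_mul hd hB
  set A := Matrix.diagonal d * B with hA
  set C := A.map ((↑) : ℝ → ℂ) with hC
  have e1 : ((1 - A) * ((1 - A)⁻¹ * (1 + A))).map ((↑) : ℝ → ℂ) = 1 + C := by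
    rw [Matrix.mul_nonsing_inv_cancel_left _ _ ((Matrix.isUnit_iff_isUnit_det _).1 hU)]
    exact (map_add Complex.ofRealHom.mapMatrix 1 A).trans (by rw [map_one]; rfl)
  have e2 : (1 - A).map ((↑) : ℝ → ℂ) = 1 - C :=
    (map_sub Complex.ofRealHom.mapMatrix 1 A).trans (by rw [map_one]; rfl)
  have e3 : (1 + C).mulVec w = μ • (1 - C).mulVec w := by
    rw [← e1, ← e2, ← Matrix.mulVec_smul, ← h, Matrix.mulVec_mulVec]
    exact congrArg (fun M => Matrix.mulVec M w) (map_mul Complex.ofRealHom.mapMatrix _ _)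
  rw [Matrix.add_mulVec, Matrix.sub_mulVec, Matrix.one_mulVec] at e3
  have e4 : (1 + μ) • C.mulVec w = (μ - 1) • w := by
    funext i
    have := congrFun e3 i
    simp only [Pi.add_apply, Pi.smul_apply, Pi.sub_apply, smul_eq_mul] at this ⊢
    linear_combination this
  have hμ1 : 1 + μ ≠ 0 := by
    intro h0
    rw [h0, zero_smul] at e4
    have : μ - 1 = -2 := by linear_combination h0
    rw [this] at e4
    exact hw ((smul_eq_zero.1 e4.symm).resolve_left (by norm_num))
  have e5 : C.mulVec w = ((μ - 1) / (1 + μ)) • w := by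
    rw [div_eq_inv_mul, mul_smul, ← e4, smul_smul, inv_mul_cancel₀ hμ1, one_smul]
  have hre := re_neg_of_eigenvector hd hB hw e5
  rw [Complex.div_re, ← add_div, div_lt_iff₀ (Complex.normSq_pos.2 hμ1), zero_mul] at hre
  simp only [Complex.sub_re, Complex.add_re, Complex.sub_im, Complex.add_im, Complex.one_re,
    Complex.one_im] at hre
  rw [← sq_lt_one_iff₀ (norm_nonneg _), ← Complex.normSq_eq_norm_sq, Complex.normSq_apply]
  linarith

/-- The step says `u - v = A (u + v)`; its weighted product with `u + v` is `∑ (u i ^ 2 - v i ^ 2) /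
d i = (u + v) ⬝ᵥ B (u + v) ≤ 0`. -/
theorem sum_sq_div_le_of_crankNicolson (hd : ∀ i, 0 < d i)
    (hB : ∀ v : Fin n → ℝ, v ≠ 0 → v ⬝ᵥ B.mulVec v < 0) {u v : Fin n → ℝ}
    (h : (1 - Matrix.diagonal d * B).mulVec u = (1 + Matrix.diagonal d * B).mulVec v) :
    ∑ i, u i ^ 2 / d i ≤ ∑ i, v i ^ 2 / d i := by
  rw [Matrix.sub_mulVec, Matrix.add_mulVec, Matrix.one_mulVec, Matrix.one_mulVec] at h
  have hs : (u + v) ⬝ᵥ B.mulVec (u + v) ≤ 0 := by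
    rcases eq_or_ne (u + v) 0 with h0 | h0
    · simp [h0]
    · exact (hB _ h0).le
  rw [← sum_mul_diagonal_mul_mulVec_div hd, Matrix.mulVec_add] at hs
  rw [← sub_nonpos, ← Finset.sum_sub_distrib]
  refine le_trans (le_of_eq (Finset.sum_congr rfl fun i _ => ?_)) hs
  have := congrFun h i
  simp only [Pi.add_apply, Pi.sub_apply] at this ⊢
  rw [← sub_div, show (Matrix.diagonal d * B).mulVec u i + (Matrix.diagonal d * B).mulVec v i
    = u i - v i by linarith]
  ring

theorem norm_sq_le_of_sum_sq_div_le (hd : ∀ i, 0 < d i) {c₀ c₁ : ℝ} (hc₀ : 0 < c₀)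
    (hc₁ : 0 ≤ c₁) (hlo : ∀ i, c₀ ≤ d i) (hhi : ∀ i, d i ≤ c₁) {u v : Fin n → ℝ}
    (h : ∑ i, u i ^ 2 / d i ≤ ∑ i, v i ^ 2 / d i) :
    ‖WithLp.toLp 2 u‖ ≤ √(c₁ / c₀) * ‖WithLp.toLp 2 v‖ := by
  have h1 : ∑ i, u i ^ 2 ≤ c₁ * ∑ i, u i ^ 2 / d i := by
    rw [Finset.mul_sum]
    refine Finset.sum_le_sum fun i _ => ?_
    rw [← mul_div_assoc, le_div_iff₀ (hd i), mul_comm]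
    exact mul_le_mul_of_nonneg_right (hhi i) (sq_nonneg _)
  have h2 : ∑ i, v i ^ 2 / d i ≤ (∑ i, v i ^ 2) / c₀ := by
    rw [Finset.sum_div]
    exact Finset.sum_le_sum fun i _ => div_le_div_of_nonneg_left (sq_nonneg _) hc₀ (hlo i)
  rw [EuclideanSpace.norm_eq, EuclideanSpace.norm_eq, ← Real.sqrt_mul (by positivity)]
  refine Real.sqrt_le_sqrt ?_
  simp only [Real.norm_eq_abs, sq_abs]
  calc ∑ i, u i ^ 2 ≤ c₁ * ((∑ i, v i ^ 2) / c₀) :=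
        h1.trans (mul_le_mul_of_nonneg_left (h.trans h2) hc₁)
    _ = c₁ / c₀ * ∑ i, v i ^ 2 := by ring

end DiagonalMul

/-! ### Application to the difference scheme. -/

theorem meshStep_pos {xL xR : ℝ} (hx : xL < xR) {Nx : ℕ} (hNx : 0 < Nx) :
    0 < meshStep xL xR Nx :=
  div_pos (sub_pos.2 hx) (Nat.cast_pos.2 hNx)

theorem meshPoint_mem_Ioo {xL xR : ℝ} (hx : xL < xR) {Nx : ℕ} (hNx : 0 < Nx) (i : Fin (Nx - 1)) :
    meshPoint xL xR Nx i ∈ Set.Ioo xL xR := by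
  have hh := meshStep_pos hx hNx
  have hi : (i : ℝ) + 1 < Nx := by
    have : (i : ℕ) + 1 < Nx := by have := i.2; omega
    exact_mod_cast this
  have hN : (Nx : ℝ) * meshStep xL xR Nx = xR - xL := by
    rw [meshStep]; field_simp
  refine ⟨?_, ?_⟩
  · rw [meshPoint]; nlinarith [mul_pos (Nat.cast_add_one_pos (α := ℝ) (i : ℕ)) hh]
  · rw [meshPoint]; nlinarith [mul_lt_mul_of_pos_right hi hh]

theorem exists_schemeMatrix_eq_diagonal_mul {α : ℝ} (hα₁ : 1 < α) (hα₂ : α < 2)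
    {S : WSLDShifts} (hS : S.Effective) (hadm : S.Admissible α)
    {xL xR T : ℝ} (hx : xL < xR) (hT : 0 < T) {dp dm : ℝ → ℝ} {κ : ℝ} (hκ : 0 ≤ κ) {Nx Nt : ℕ}
    (hNx : 0 < Nx) (hNt : 0 < Nt) (hD : coeffMatrix xL xR dm Nx = κ • coeffMatrix xL xR dp Nx) :
    ∃ B : Matrix (Fin (Nx - 1)) (Fin (Nx - 1)) ℝ,
      schemeMatrix S α xL xR T dp dm Nx Nt
        = Matrix.diagonal (fun i => dp (meshPoint xL xR Nx i)) * B ∧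
      ∀ v, v ≠ 0 → v ⬝ᵥ B.mulVec v < 0 := by
  have hh := meshStep_pos hx hNx
  have hNt' : (0 : ℝ) < Nt := Nat.cast_pos.2 hNt
  refine ⟨((T / Nt) / (2 * meshStep xL xR Nx ^ α)) •
    (S.matrix α (Nx - 1) + κ • (S.matrix α (Nx - 1)).transpose), ?_, fun v hv => ?_⟩
  · rw [schemeMatrix, hD, Matrix.mul_smul, Matrix.mul_add, Matrix.mul_smul, Matrix.smul_mul]
    rfl
  · have h := S.quadratic_form_neg hS hadm hα₁ hα₂ hv
    rw [Matrix.smul_mulVec, dotProduct_smul, Matrix.add_mulVec, dotProduct_add,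
      Matrix.smul_mulVec, dotProduct_smul, Matrix.mulVec_transpose,
      dotProduct_comm v (Matrix.vecMul v _),
      ← Matrix.dotProduct_mulVec, smul_eq_mul, smul_eq_mul]
    refine mul_neg_of_pos_of_neg (by positivity) ?_
    nlinarith

theorem theorem4p3 (α : ℝ) (hα₁ : 1 < α) (hα₂ : α < 2)
    (S : WSLDShifts) (hS : S.Effective) (hadm : S.Admissible α)
    (xL xR T : ℝ) (hx : xL < xR) (hT : 0 < T)
    (dp dm : ℝ → ℝ) (hdp : ∀ x ∈ Set.Ioo xL xR, 0 < dp x)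
    (κ : ℝ) (hκ : 0 ≤ κ)
    (hD : ∀ Nx : ℕ, 0 < Nx → coeffMatrix xL xR dm Nx = κ • coeffMatrix xL xR dp Nx) :
    UnconditionallyStable S α xL xR T dp dm ∧
    ∀ Nx Nt : ℕ, 0 < Nx → 0 < Nt →
      (∀ z ∈ spectrum ℂ ((schemeMatrix S α xL xR T dp dm Nx Nt).map ((↑) : ℝ → ℂ)), z.re < 0) ∧
      IsUnit (1 - schemeMatrix S α xL xR T dp dm Nx Nt) ∧
      spectralRadius ℂ ((amplificationMatrix S α xL xR T dp dm Nx Nt).map ((↑) : ℝ → ℂ)) < 1 := by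
  -- The maximum covers negative `c₁`, which the bounds on `d₊` do not exclude when `N_x = 1` and
  -- there are no interior mesh points.
  refine ⟨fun c₀ c₁ hc₀ => ⟨√(max c₁ 0 / c₀), ?_⟩, ?_⟩
  · intro Nx Nt hNx hNt hc f U V hU hV n hn
    have hd (i) := hdp _ (meshPoint_mem_Ioo hx hNx i)
    obtain ⟨B, hA, hB⟩ :=
      exists_schemeMatrix_eq_diagonal_mul hα₁ hα₂ hS hadm hx hT hκ hNx hNt (hD Nx hNx)
    refine norm_sq_le_of_sum_sq_div_le hd hc₀ (le_max_right _ _) (fun i => (hc i).1)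
      (fun i => (hc i).2.trans (le_max_left _ _)) ?_
    induction n with
    | zero => exact le_rfl
    | succ k ih =>
      refine le_trans (sum_sq_div_le_of_crankNicolson hd hB ?_) (ih (by omega))
      rw [← hA, Matrix.mulVec_sub, Matrix.mulVec_sub, hU k hn, hV k hn, add_sub_add_right_eq_sub]
  · intro Nx Nt hNx hNt
    have hd (i) := hdp _ (meshPoint_mem_Ioo hx hNx i)
    obtain ⟨B, hA, hB⟩ :=
      exists_schemeMatrix_eq_diagonal_mul hα₁ hα₂ hS hadm hx hT hκ hNx hNt (hD Nx hNx)
    rw [amplificationMatrix, hA]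
    refine ⟨fun z hz => ?_, isUnit_one_sub_diagonal_mul hd hB,
      Matrix.spectralRadius_lt_one fun μ hμ => norm_lt_one_of_mem_spectrum_amplification hd hB hμ⟩
    obtain ⟨w, hw, h⟩ := Matrix.exists_mulVec_eq_smul_of_mem_spectrum hz
    exact re_neg_of_eigenvector hd hB hw h
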